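/- **Setting.** Let $G$ be a compact, connected and simply connected Lie group whose Lie algebra $\mathcal G$ is simple, with a negative definite multiple $\langle\cdot,\cdot\rangle$ of the Killing form, and let $e_a$ be a basis of $\mathcal G$ with $\langle e_a,e_b\rangle=-\delta_{ab}$. Matrix notation is used: $Xg$ and $gX$ denote the values at $g\in G$ of the right- and left-invariant vector fields extending $X\in\mathcal G$, and $[g,X]=gX-Xg$. For a smooth function $f$ on $G$, the derivatives $\nabla f,\nabla' f\in\mathcal G$ are defined by $$\langle X,\nabla f(g)\rangle=\tfrac{d}{dt}\big|_{t=0}f(e^{tX}g),\qquad \langle X,\nabla' f(g)\rangle=\tfrac{d}{dt}\big|_{t=0}f(ge^{tX})\qquad(X\in\mathcal G),$$ and $\nabla_i,\nabla_i'$ denote the same derivatives with respect to the $i$-th variable of a function of two variables. Let $e_a^{i,R}$, $e_a^{i,L}$ be the right- and left-invariant vector fields extending $e_a$ on the $i$-th factor of $G\times G$. The quasi-Poisson bracket on $G\times G$ is $\{\mathcal F,\mathcal H\}=(d\mathcal F\otimes d\mathcal H)(\Pi)$ with (summation over $a$, no factor $\frac12$ in the wedge product) $$2\Pi = e_a^{1,L}\wedge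 e_a^{2,R} + e_a^{1,R}\wedge e_a^{2,L} +e_a^{1,R}\wedge e_a^{1,L} +e_a^{2,L}\wedge e_a^{2,R}- e_a^{1,R}\wedge e_a^{2,R} - e_a^{2,L}\wedge e_a^{1,L}.$$ Let $G_0$ be a maximal torus of $G$ with Lie algebra $\mathcal G_0$. Write $X=X_0+X_\perp$ according to $\mathcal G=\mathcal G_0\oplus\mathcal G_0^\perp$. An element of $G$ is regular if its centralizer is a maximal torus; $G^{\rm reg}$ and $G_0^{\rm reg}$ are the sets of regular elements of $G$ and $G_0$. For $Q\in G_0^{\rm reg}$ put $$\mathcal R(Q)X=\tfrac12(\mathrm{Ad}_Q+\mathrm{id})\circ(\mathrm{Ad}_Q-\mathrm{id})|_{\mathcal G_0^\perp}^{-1}(X_\perp).$$ Consider the slices $$\mathfrak S_0^{\rm reg}=\{(Q,g): Q\in G_0^{\rm reg},\ g\in G\},\qquad \mathfrak S_0'^{\rm reg}=\{(g,Q): g\in G,\ Q\in G_0^{\rm reg}\}.$$ The derivative of a function on a slice with respect to the variable $Q$ is $\mathcal G_0$-valued: $\langle X,\nabla_1F(Q,g)\rangle=\frac{d}{dt}|_{t=0}F(e^{tX}Q,g)$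 for $X\in\mathcal G_0$ on $\mathfrak S_0^{\rm reg}$, and similarly for $\nabla_2F(g,Q)$ on $\mathfrak S_0'^{\rm reg}$. For restrictions $F,H$ of smooth functions $\mathcal F,\mathcal H$ on $G^{\rm reg}\times G$ (respectively on $G\times G^{\rm reg}$) that are invariant under simultaneous conjugation by $G$, the reduced bracket of $F$ and $H$ on the slice is the restriction of $\{\mathcal F,\mathcal H\}$. For arbitrary smooth functions on the slices, $\{\cdot,\cdot\}_{\rm red}$ and $\{\cdot,\cdot\}'_{\rm red}$ denote $$\{F,H\}_{\rm red}(Q,g) = \langle \nabla_1 H, \nabla_2 F\rangle - \langle \nabla_1 F, \nabla_2 H\rangle + \langle \nabla_2' F, \mathcal R(Q)\nabla_2' H\rangle - \langle \nabla_2 F, \mathcal R(Q)\nabla_2 H\rangle,$$ $$\{F,H\}'_{\rm red}(g,Q) = \langle \nabla_2 F, \nabla_1 H\rangle - \langle \nabla_2 H, \nabla_1 F\rangle + \langle \nabla_1 F, \mathcal R(Q)\nabla_1 H\rangle - \langle \nabla_1' F, \mathcal R(Q)\nabla_1' H\rangle.$$ **Proposition 4.4.** Let $\phi\in C^\infty(G)$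 be invariant under conjugation. (1) Let $H(Q,g)=\phi(g)$ be the restriction to $\mathfrak S_0^{\rm reg}$ of $\mathcal H=\pi_2^*\phi$, $\mathcal H(g_1,g_2)=\phi(g_2)$. If $\mathcal F$ is a smooth function on $G^{\rm reg}\times G$ invariant under simultaneous conjugation and $F$ is its restriction to the slice, then the reduced bracket $\{\mathcal F,\mathcal H\}(Q,g)$ equals $$-\langle\nabla_1F(Q,g),\nabla\phi(g)\rangle+\langle\nabla_2'F(Q,g)-\nabla_2F(Q,g),\mathcal R(Q)\nabla\phi(g)\rangle ,$$ and for every smooth $F$ on $\mathfrak S_0^{\rm reg}$ the bracket $\{F,H\}_{\rm red}(Q,g)$ equals the same expression. The reduced evolution equations associated with $H$ are $$\dot Q=-(\nabla\phi(g))_0\,Q,\qquad \dot g=[g,\mathcal R(Q)\nabla\phi(g)]\qquad\text{on }\mathfrak S_0^{\rm reg}.$$ That is, the right-hand sides define the unique vector field on $\mathfrak S_0^{\rm reg}$, tangent to it, along which the derivative of every smooth $F$ on $\mathfrak S_0^{\rm reg}$ is $\{F,H\}_{\rm red}$; and a differentiable curve $(Q(t),g(t))$ in $\mathfrak S_0^{\rm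 reg}$ satisfies $\frac{d}{dt}F(Q(t),g(t))=\{F,H\}_{\rm red}(Q(t),g(t))$ for all smooth $F$ on $\mathfrak S_0^{\rm reg}$ if and only if it solves these equations. (2) Let $H(g,Q)=\phi(g)$ be the restriction to $\mathfrak S_0'^{\rm reg}$ of $\mathcal H=\pi_1^*\phi$, $\mathcal H(g_1,g_2)=\phi(g_1)$. If $\mathcal F$ is a smooth function on $G\times G^{\rm reg}$ invariant under simultaneous conjugation and $F$ is its restriction to the slice, then the reduced bracket $\{\mathcal F,\mathcal H\}(g,Q)$ equals $$\langle\nabla_2F(g,Q),\nabla\phi(g)\rangle-\langle\nabla_1'F(g,Q)-\nabla_1F(g,Q),\mathcal R(Q)\nabla\phi(g)\rangle ,$$ and for every smooth $F$ on $\mathfrak S_0'^{\rm reg}$ the bracket $\{F,H\}'_{\rm red}(g,Q)$ equals the same expression. The reduced evolution equations associated with $H$, in the same sense as in (1), are $$\dot Q=(\nabla\phi(g))_0\,Q,\qquad \dot g=-[g,\mathcal R(Q)\nabla\phi(g)]\qquad\text{on }\mathfrak S_0'^{\rm reg}.$$ -/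

import Mathlib

open scoped Manifold ContDiff Topology

noncomputable section

namespace QPDouble

/-! ### Lie groups: exponential map, translations, adjoint action -/

section LieGroupBasics

variable {E : Type*} [NormedAddCommGroup E] [NormedSpace ℝ E]
  {H : Type*} [TopologicalSpace H] (I : ModelWithCorners ℝ E H)
  {G : Type*} [TopologicalSpace G] [ChartedSpace H G] [Group G]

/-- `γ` is the one-parameter subgroup of `G` with velocity `X` at the unit element. (A homomorphism
`ℝ → G` that is differentiable at `0` is automatically smooth.) -/
def IsOneParam (γ : ℝ → G) (X : GroupLieAlgebra I G) : Prop :=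
  (∀ s t, γ (s + t) = γ s * γ t) ∧
    HasMFDerivAt 𝓘(ℝ, ℝ) I γ 0 ((1 : ℝ →L[ℝ] ℝ).smulRight X)

/-- The exponential map of `G`: the value at time `1` of the (unique) one-parameter subgroup with
velocity `X`. -/
def gexp (X : GroupLieAlgebra I G) : G :=
  (Classical.epsilon fun γ : ℝ → G => IsOneParam I γ X) 1

/-- `Y g`, the value at `g` of the right-invariant vector field extending `Y`. -/
def rmulVec (Y : GroupLieAlgebra I G) (g : G) : TangentSpace I g :=
  mfderiv I I (fun x : G => x * g) 1 Y

/-- `g Y`, the value at `g` of the left-invariant vector field extending `Y`. -/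
def lmulVec (g : G) (Y : GroupLieAlgebra I G) : TangentSpace I g :=
  mulInvariantVectorField Y g

/-- The tangent vector `[g, Y] = g Y - Y g` at `g`. -/
def commVec (g : G) (Y : GroupLieAlgebra I G) : TangentSpace I g :=
  lmulVec I g Y - rmulVec I Y g

/-- The adjoint action `Ad_g X = g X g⁻¹`, the derivative at `1` of conjugation by `g`. -/
def Ad (g : G) (X : GroupLieAlgebra I G) : GroupLieAlgebra I G :=
  mfderiv I I (fun x : G => g * x * g⁻¹) 1 X

end LieGroupBasics

/-! ### Tori and regular elements -/

section Tori

variable {G : Type*} [TopologicalSpace G] [Group G]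

/-- A torus in a compact Lie group: a closed connected Abelian subgroup. -/
def IsTorus (T : Subgroup G) : Prop :=
  IsClosed (T : Set G) ∧ IsConnected (T : Set G) ∧ ∀ x ∈ T, ∀ y ∈ T, x * y = y * x

def IsMaximalTorus (T : Subgroup G) : Prop := Maximal IsTorus T

/-- `g` is regular if its isotropy group with respect to conjugations is a maximal torus. -/
def IsRegular (g : G) : Prop := IsMaximalTorus (Subgroup.centralizer {g})

end Tori

section TorusAlgebra

variable {E : Type*} [NormedAddCommGroup E] [NormedSpace ℝ E]
  {H : Type*} [TopologicalSpace H] (I : ModelWithCorners ℝ E H)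
  {G : Type*} [TopologicalSpace G] [ChartedSpace H G] [Group G]

theorem IsOneParam.map_zero {γ : ℝ → G} {X : GroupLieAlgebra I G} (h : IsOneParam I γ X) :
    γ 0 = 1 := by
  have := h.1 0 0
  simpa using this

theorem IsOneParam.one : IsOneParam I (fun _ => (1 : G)) 0 := by
  refine ⟨fun s t => by simp, ?_⟩
  refine (hasMFDerivAt_const (1 : G) (0 : ℝ)).congr_mfderiv (ContinuousLinearMap.ext_ring ?_)
  change (0 : GroupLieAlgebra I G) = (1 : ℝ) • (0 : GroupLieAlgebra I G)
  simp

theorem IsOneParam.comp_mul {γ : ℝ → G} {X : GroupLieAlgebra I G} (hγ : IsOneParam I γ X) (c : ℝ) :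
    IsOneParam I (fun t => γ (c * t)) (c • X) := by
  refine ⟨fun s t => by simp only [mul_add, hγ.1], ?_⟩
  have hc : HasMFDerivAt 𝓘(ℝ, ℝ) 𝓘(ℝ, ℝ) (fun t : ℝ => c * t) 0
      ((1 : ℝ →L[ℝ] ℝ).smulRight c) := by
    have h : HasFDerivAt (fun t : ℝ => c * t) ((1 : ℝ →L[ℝ] ℝ).smulRight c) 0 := by
      refine ((hasDerivAt_id (0 : ℝ)).const_mul c).hasFDerivAt.congr_fderiv ?_
      ext
      simp
    exact h.hasMFDerivAt
  have h2 := hγ.2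
  rw [← mul_zero c] at h2
  refine (h2.comp (0 : ℝ) hc).congr_mfderiv (ContinuousLinearMap.ext_ring ?_)
  change ((1 : ℝ) • c) • X = (1 : ℝ) • (c • X)
  simp

variable [LieGroup I ∞ G]

theorem IsOneParam.mul {γ δ : ℝ → G} {X Y : GroupLieAlgebra I G} (hγ : IsOneParam I γ X)
    (hδ : IsOneParam I δ Y) (c : ∀ s t, γ s * δ t = δ t * γ s) :
    IsOneParam I (fun t => γ t * δ t) (X + Y) := by
  refine ⟨fun s t => ?_, ?_⟩
  · simp only [hγ.1, hδ.1]
    rw [mul_assoc, mul_assoc, ← mul_assoc (γ t), c t s, mul_assoc]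
  · have h0 := hγ.map_zero
    have h1 := hδ.map_zero
    have hm : MDifferentiableAt (I.prod I) I (fun p : G × G => p.1 * p.2) (γ 0, δ 0) :=
      (contMDiff_mul I ∞).mdifferentiableAt (by simp)
    have key := hm.hasMFDerivAt.comp (0 : ℝ) (hγ.2.prodMk hδ.2)
    refine key.congr_mfderiv (ContinuousLinearMap.ext_ring ?_)
    refine (mfderiv_prod_eq_add_apply hm).trans ?_
    have e1 : (fun z : G => z * δ 0) = id := by funext z; simp [h1]
    have e2 : (fun z : G => γ 0 * z) = id := by funext z; simp [h0]
    change mfderiv I I (fun z : G => z * δ 0) (γ 0) _ +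
      mfderiv I I (fun z : G => γ 0 * z) (δ 0) _ = _
    rw [e1, e2, mfderiv_id, mfderiv_id]
    change (1 : ℝ) • X + (1 : ℝ) • Y = (1 : ℝ) • (X + Y)
    rw [smul_add]

/-- The Lie algebra of a torus `T < G`: the velocities of the one-parameter subgroups of `G` that
run in `T`. -/
def torusAlgebra (T : Subgroup G) (hT : IsTorus T) : Submodule ℝ (GroupLieAlgebra I G) where
  carrier := {X | ∃ γ : ℝ → G, IsOneParam I γ X ∧ ∀ t, γ t ∈ T}
  zero_mem' := ⟨_, IsOneParam.one I, fun _ => T.one_mem⟩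
  add_mem' := by
    rintro X Y ⟨γ, hγ, hγT⟩ ⟨δ, hδ, hδT⟩
    exact ⟨_, hγ.mul I hδ fun s t => hT.2.2 _ (hγT s) _ (hδT t),
      fun t => T.mul_mem (hγT t) (hδT t)⟩
  smul_mem' := by
    rintro c X ⟨γ, hγ, hγT⟩
    exact ⟨_, hγ.comp_mul I c, fun t => hγT _⟩

end TorusAlgebra

instance leInfty_minSmoothness : ENat.LEInfty (minSmoothness ℝ 3) := by
  rw [minSmoothness_of_isRCLikeNormedField]
  infer_instance

/-! ### Gradients and the dynamical r-matrix -/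

section Gradients

variable {E : Type*} [NormedAddCommGroup E] [NormedSpace ℝ E]
  {H : Type*} [TopologicalSpace H] {I : ModelWithCorners ℝ E H}
  {G : Type*} [TopologicalSpace G] [ChartedSpace H G] [Group G]
  (B : LinearMap.BilinForm ℝ (GroupLieAlgebra I G)) (W : Submodule ℝ (GroupLieAlgebra I G))

/-- The vector `v ∈ W` with `⟨X, v⟩ = ℓ X` for all `X ∈ W`. It exists and is unique if the form `B`
is definite on the finite-dimensional space `W` and `ℓ` is linear. -/
def represent (ℓ : GroupLieAlgebra I G → ℝ) : GroupLieAlgebra I G :=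
  Classical.epsilon fun v => v ∈ W ∧ ∀ X ∈ W, B X v = ℓ X

/-- `X_0`, the component in `W` of `X` with respect to `W ⊕ W^⊥`. -/
def proj0 (X : GroupLieAlgebra I G) : GroupLieAlgebra I G :=
  represent B W fun Z => B Z X

/-- `X_⊥`, the component in `W^⊥` of `X` with respect to `W ⊕ W^⊥`. -/
def projPerp (X : GroupLieAlgebra I G) : GroupLieAlgebra I G := X - proj0 B W X

/-- `(Ad_Q - id)⁻¹ X_⊥`, the inverse being taken on `W^⊥`. -/
def invAdSubOne (Q : G) (X : GroupLieAlgebra I G) : GroupLieAlgebra I G :=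
  Classical.epsilon fun Y => Y ∈ B.orthogonal W ∧ Ad I Q Y - Y = projPerp B W X

/-- The r-matrix `ℛ(Q) X = 1/2 (Ad_Q + id) (Ad_Q - id)⁻¹ X_⊥`, where `W` is the Lie algebra of the
maximal torus. -/
def rMatrix (Q : G) (X : GroupLieAlgebra I G) : GroupLieAlgebra I G :=
  (1 / 2 : ℝ) • (Ad I Q (invAdSubOne B W Q X) + invAdSubOne B W Q X)

/-- The derivative of `f` at `g` along the right-invariant vector field: `d/dt f(exp(tX) g)` at
`t = 0`. -/
def derR (X : GroupLieAlgebra I G) (f : G → ℝ) (g : G) : ℝ :=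
  deriv (fun t : ℝ => f (gexp I (t • X) * g)) 0

/-- The derivative of `f` at `g` along the left-invariant vector field: `d/dt f(g exp(tX))` at
`t = 0`. -/
def derL (X : GroupLieAlgebra I G) (f : G → ℝ) (g : G) : ℝ :=
  deriv (fun t : ℝ => f (g * gexp I (t • X))) 0

/-- `∇f(g)`: `⟨X, ∇f(g)⟩ = d/dt f(exp(tX) g)` at `t = 0`, for all `X` in the Lie algebra. -/
def nabla (f : G → ℝ) (g : G) : GroupLieAlgebra I G := represent B ⊤ fun X => derR X f g

/-- `∇'f(g)`: `⟨X, ∇'f(g)⟩ = d/dt f(g exp(tX))` at `t = 0`, for all `X` in the Lie algebra. -/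
def nabla' (f : G → ℝ) (g : G) : GroupLieAlgebra I G := represent B ⊤ fun X => derL X f g

/-- The `W`-valued derivative of a function `f` on the torus with Lie algebra `W`:
`⟨X, ∇f(Q)⟩ = d/dt f(exp(tX) Q)` at `t = 0`, for all `X ∈ W`. -/
def nablaT (f : G → ℝ) (Q : G) : GroupLieAlgebra I G := represent B W fun X => derR X f Q

/-! Partial derivatives of functions of two variables. -/

def nabla₁ (F : G × G → ℝ) (p : G × G) : GroupLieAlgebra I G := nabla B (fun x => F (x, p.2)) p.1

def nabla₁' (F : G × G → ℝ) (p : G × G) : GroupLieAlgebra I G := nabla' B (fun x => F (x, p.2)) p.1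

def nabla₂ (F : G × G → ℝ) (p : G × G) : GroupLieAlgebra I G := nabla B (fun x => F (p.1, x)) p.2

def nabla₂' (F : G × G → ℝ) (p : G × G) : GroupLieAlgebra I G := nabla' B (fun x => F (p.1, x)) p.2

def nablaT₁ (F : G × G → ℝ) (p : G × G) : GroupLieAlgebra I G :=
  nablaT B W (fun x => F (x, p.2)) p.1

def nablaT₂ (F : G × G → ℝ) (p : G × G) : GroupLieAlgebra I G :=
  nablaT B W (fun x => F (p.1, x)) p.2

end Gradients

/-! ### The quasi-Poisson bracket of the double `G × G` -/

section Double

variable {E : Type*} [NormedAddCommGroup E] [NormedSpace ℝ E]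
  {H : Type*} [TopologicalSpace H] {I : ModelWithCorners ℝ E H}
  {G : Type*} [TopologicalSpace G] [ChartedSpace H G] [Group G]

/-! The vector fields on `G × G` given by the right- and left-invariant vector fields extending `X`
and tangent to the first, respectively the second, factor, as derivations. -/

def vecR₁ (X : GroupLieAlgebra I G) (F : G × G → ℝ) (p : G × G) : ℝ :=
  derR X (fun x => F (x, p.2)) p.1

def vecL₁ (X : GroupLieAlgebra I G) (F : G × G → ℝ) (p : G × G) : ℝ :=
  derL X (fun x => F (x, p.2)) p.1

def vecR₂ (X : GroupLieAlgebra I G) (F : G × G → ℝ) (p : G × G) : ℝ :=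
  derR X (fun x => F (p.1, x)) p.2

def vecL₂ (X : GroupLieAlgebra I G) (F : G × G → ℝ) (p : G × G) : ℝ :=
  derL X (fun x => F (p.1, x)) p.2

/-- `(dF ⊗ dK)(V ∧ U)`; the wedge product does not contain `1/2`. -/
def wedge {M : Type*} (V U : (M → ℝ) → M → ℝ) (F K : M → ℝ) (p : M) : ℝ :=
  V F p * U K p - U F p * V K p

/-- The quasi-Poisson bracket `{F, K} = (dF ⊗ dK)(Π)` of the internally fused double, where
`2 Π = e_a^{1,L} ∧ e_a^{2,R} + e_a^{1,R} ∧ e_a^{2,L} + e_a^{1,R} ∧ e_a^{1,L}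
  + e_a^{2,L} ∧ e_a^{2,R} - e_a^{1,R} ∧ e_a^{2,R} - e_a^{2,L} ∧ e_a^{1,L}` (sum over `a`)
and `e` is a basis with `⟨e_a, e_b⟩ = - δ_{ab}`. -/
def qpBracket {ι : Type*} [Fintype ι] (e : ι → GroupLieAlgebra I G) (F K : G × G → ℝ)
    (p : G × G) : ℝ :=
  (1 / 2) * ∑ a, (wedge (vecL₁ (e a)) (vecR₂ (e a)) F K p + wedge (vecR₁ (e a)) (vecL₂ (e a)) F K p
    + wedge (vecR₁ (e a)) (vecL₁ (e a)) F K p + wedge (vecL₂ (e a)) (vecR₂ (e a)) F K p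
    - wedge (vecR₁ (e a)) (vecR₂ (e a)) F K p - wedge (vecL₂ (e a)) (vecL₁ (e a)) F K p)

end Double

/-! ### Invariant functions, the two slices, and the reduced brackets -/

section Slices

variable {E : Type*} [NormedAddCommGroup E] [NormedSpace ℝ E]
  {H : Type*} [TopologicalSpace H] (I : ModelWithCorners ℝ E H)
  {G : Type*} [TopologicalSpace G] [ChartedSpace H G] [Group G]

/-- `φ ∈ C^∞(G)^G`. -/
def IsClassFunction (φ : G → ℝ) : Prop :=
  ContMDiff I 𝓘(ℝ, ℝ) ∞ φ ∧ ∀ η g, φ (η * g * η⁻¹) = φ g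

/-- `F ∈ C^∞(S)^G`, for a subset `S` of `G × G` that is open and stable under simultaneous
conjugations. Functions on `S` are represented by functions on `G × G` whose values off `S` do not
matter; the restriction of such a function to a slice is represented by the same function. -/
def IsSmoothInvariantOn (S : Set (G × G)) (F : G × G → ℝ) : Prop :=
  (∀ p ∈ S, ContMDiffAt (I.prod I) 𝓘(ℝ, ℝ) ∞ F p) ∧
    ∀ p ∈ S, ∀ η : G, F (η * p.1 * η⁻¹, η * p.2 * η⁻¹) = F p

/-- The pairs `(g₁, g₂)` with `g₁` regular, an open set. -/
def regSet₁ : Set (G × G) := {p | IsRegular p.1}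

/-- The pairs `(g₁, g₂)` with `g₂` regular, an open set. -/
def regSet₂ : Set (G × G) := {p | IsRegular p.2}

/-- The slice of pairs `(Q, g)` with `Q` a regular element of the torus `T`. -/
def slice₁ (T : Subgroup G) : Set (G × G) := {p | p.1 ∈ T ∧ IsRegular p.1}

/-- The slice of pairs `(g, Q)` with `Q` a regular element of the torus `T`. -/
def slice₂ (T : Subgroup G) : Set (G × G) := {p | p.2 ∈ T ∧ IsRegular p.2}

/-- `F` is a smooth function on the slice `{(Q, g)}`, which is an open subset of the closed
submanifold `T × G` of `G × G`. (Only the values of `F` on the slice matter.) -/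
def IsSmoothSlice₁ (T : Subgroup G) (F : G × G → ℝ) : Prop :=
  ∀ p ∈ slice₁ T, ContMDiffWithinAt (I.prod I) 𝓘(ℝ, ℝ) ∞ F {q | q.1 ∈ T} p

/-- `F` is a smooth function on the slice `{(g, Q)}`, which is an open subset of the closed
submanifold `G × T` of `G × G`. (Only the values of `F` on the slice matter.) -/
def IsSmoothSlice₂ (T : Subgroup G) (F : G × G → ℝ) : Prop :=
  ∀ p ∈ slice₂ T, ContMDiffWithinAt (I.prod I) 𝓘(ℝ, ℝ) ∞ F {q | q.2 ∈ T} p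

variable {I} (B : LinearMap.BilinForm ℝ (GroupLieAlgebra I G))
  (W : Submodule ℝ (GroupLieAlgebra I G))

/-- The reduced bracket on the slice `{(Q, g)}`, `W` being the Lie algebra of the torus. -/
def redBracket₁ (F K : G × G → ℝ) (p : G × G) : ℝ :=
  B (nablaT₁ B W K p) (nabla₂ B F p) - B (nablaT₁ B W F p) (nabla₂ B K p)
    + B (nabla₂' B F p) (rMatrix B W p.1 (nabla₂' B K p))
    - B (nabla₂ B F p) (rMatrix B W p.1 (nabla₂ B K p))

/-- The reduced bracket on the slice `{(g, Q)}`, `W` being the Lie algebra of the torus. -/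
def redBracket₂ (F K : G × G → ℝ) (p : G × G) : ℝ :=
  B (nablaT₂ B W F p) (nabla₁ B K p) - B (nablaT₂ B W K p) (nabla₁ B F p)
    + B (nabla₁ B F p) (rMatrix B W p.2 (nabla₁ B K p))
    - B (nabla₁' B F p) (rMatrix B W p.2 (nabla₁' B K p))

variable (I) in
/-- The derivative of a function on the slice `{(Q, g)}` along a vector tangent to the slice. -/
def sliceDeriv₁ (T : Subgroup G) (F : G × G → ℝ) (p : G × G) (w : TangentSpace (I.prod I) p) : ℝ :=
  mfderivWithin (I.prod I) 𝓘(ℝ, ℝ) F {q | q.1 ∈ T} p w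

variable (I) in
/-- The derivative of a function on the slice `{(g, Q)}` along a vector tangent to the slice. -/
def sliceDeriv₂ (T : Subgroup G) (F : G × G → ℝ) (p : G × G) (w : TangentSpace (I.prod I) p) : ℝ :=
  mfderivWithin (I.prod I) 𝓘(ℝ, ℝ) F {q | q.2 ∈ T} p w

end Slices

end QPDouble

end

/-! Two facts carry the computation: `φ` is a class function, so its left and right derivatives
agree, and an invariant `F` has vanishing derivative along simultaneous conjugation.

Let `R_i`, `L_i` be the right and left derivatives of `F` along `e_a` in the `i`-th variable and `r`
the derivative of `φ`. Against a Hamiltonian depending on the second variable, the `a`-th summand of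
`2Π` gives `(2 L_1 + L_2 - R_2) r`. Invariance says `R_1 - L_1 = L_2 - R_2`
(`derR_sub_derL_eq_of_invariant`), so this is `(R_1 + L_1) r`, and summing over the basis yields
`-1/2 ⟨∇₁F + ∇₁'F, ∇φ⟩`.

At `Q` in the torus, `∇₁F = Ad_Q ∇₁'F`. Regularity makes the Lie algebra of the torus the whole
fixed space of `Ad_Q` (`Ad_eq_self_iff`), so `Ad_Q - 1` is invertible on the orthogonal complement.
On the torus part of `∇φ` both gradients pair as the torus gradient does. On the complement,
antisymmetry of the Cayley transform (`apply_sub_cayley`) converts the sum of gradients into `⟨∇₁F -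
∇₁'F, ℛ(Q)∇φ⟩` (`apply_nabla_add_nabla'`), and invariance turns `∇₁F - ∇₁'F` into `∇₂'F - ∇₂F`. The
other slice differs only in signs.

The evolution equations are read off by duality: `⟨∇'f - ∇f, Z⟩` is the derivative of `f` along `[g,
Z]`, and a torus gradient sees only the torus component. Functions pulled back from the two factors
separate tangent vectors, which gives uniqueness.

The exponential map, the gradients and `ℛ` are defined by choice. They become usable through
completeness of left-invariant fields (`exists_isOneParam`), uniqueness of integral curves
(`IsOneParam.eq`) and definiteness of the form. -/

noncomputable section

namespace QPDouble

/-! ### Velocities of curves -/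

section Velocity

variable {E : Type*} [NormedAddCommGroup E] [NormedSpace ℝ E]
  {H : Type*} [TopologicalSpace H] {I : ModelWithCorners ℝ E H}
  {M : Type*} [TopologicalSpace M] [ChartedSpace H M]
  {E' : Type*} [NormedAddCommGroup E'] [NormedSpace ℝ E']
  {H' : Type*} [TopologicalSpace H'] {I' : ModelWithCorners ℝ E' H'}
  {M' : Type*} [TopologicalSpace M'] [ChartedSpace H' M']

/-- `v` is the velocity at time `t` of the curve `γ`. -/
def HasVelocity (I : ModelWithCorners ℝ E H) (γ : ℝ → M) (t : ℝ) (v : TangentSpace I (γ t)) :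
    Prop :=
  HasMFDerivAt 𝓘(ℝ, ℝ) I γ t ((1 : ℝ →L[ℝ] ℝ).smulRight v)

theorem HasVelocity.unique {γ : ℝ → M} {t : ℝ} {v w : TangentSpace I (γ t)}
    (hv : HasVelocity I γ t v) (hw : HasVelocity I γ t w) : v = w := by
  have h := hasMFDerivAt_unique hv hw
  have h1 : (1 : ℝ) • v = (1 : ℝ) • w := congrArg (fun L : ℝ →L[ℝ] E => L 1) h
  simpa only [one_smul] using h1

theorem _root_.MDifferentiableAt.exists_hasVelocity {γ : ℝ → M} {t : ℝ}
    (h : MDifferentiableAt 𝓘(ℝ, ℝ) I γ t) : ∃ v, HasVelocity I γ t v := by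
  refine ⟨(mfderiv 𝓘(ℝ, ℝ) I γ t : ℝ →L[ℝ] E) 1, h.hasMFDerivAt.congr_mfderiv ?_⟩
  refine ContinuousLinearMap.ext_ring ?_
  change (mfderiv 𝓘(ℝ, ℝ) I γ t : ℝ →L[ℝ] E) 1 =
    (1 : ℝ) • (mfderiv 𝓘(ℝ, ℝ) I γ t : ℝ →L[ℝ] E) 1
  rw [one_smul]

theorem HasVelocity.comp_hasMFDerivAt {γ : ℝ → M} {t : ℝ} {v : TangentSpace I (γ t)} {f : M → M'}
    {L : TangentSpace I (γ t) →L[ℝ] TangentSpace I' (f (γ t))}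
    (hf : HasMFDerivAt I I' f (γ t) L) (hv : HasVelocity I γ t v) :
    HasVelocity I' (f ∘ γ) t (L v) := by
  refine (HasMFDerivAt.comp t hf hv).congr_mfderiv ?_
  refine ContinuousLinearMap.ext_ring ?_
  change L ((1 : ℝ) • v) = (1 : ℝ) • L v
  rw [one_smul, one_smul]

theorem HasVelocity.comp {γ : ℝ → M} {t : ℝ} {v : TangentSpace I (γ t)} {f : M → M'}
    (hf : MDifferentiableAt I I' f (γ t)) (hv : HasVelocity I γ t v) :
    HasVelocity I' (f ∘ γ) t (mfderiv I I' f (γ t) v) :=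
  hv.comp_hasMFDerivAt hf.hasMFDerivAt

theorem HasVelocity.prodMk {γ : ℝ → M} {δ : ℝ → M'} {t : ℝ} {v : TangentSpace I (γ t)}
    {w : TangentSpace I' (δ t)} (hv : HasVelocity I γ t v) (hw : HasVelocity I' δ t w) :
    HasVelocity (I.prod I') (fun s => (γ s, δ s)) t ((v, w) : E × E') := by
  refine (HasMFDerivAt.prodMk hv hw).congr_mfderiv ?_
  exact ContinuousLinearMap.ext_ring rfl

theorem HasVelocity.comp_add_const {γ : ℝ → M} {t c : ℝ} {v : TangentSpace I (γ (t + c))}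
    (hv : HasVelocity I γ (t + c) v) :
    HasVelocity I (fun s => γ (s + c)) t v := by
  have h : HasFDerivAt (fun t : ℝ => t + c) (ContinuousLinearMap.id ℝ ℝ) t :=
    (hasFDerivAt_id t).add_const c
  exact HasMFDerivAt.comp (f := fun s : ℝ => s + c) t hv h.hasMFDerivAt

theorem HasVelocity.hasDerivAt {f : ℝ → ℝ} {t a : ℝ}
    (hv : HasVelocity 𝓘(ℝ, ℝ) f t a) : HasDerivAt f a t := by
  have h : HasFDerivAt f ((1 : ℝ →L[ℝ] ℝ).smulRight a : ℝ →L[ℝ] ℝ) t :=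
    hasMFDerivAt_iff_hasFDerivAt.1 hv
  simpa using h.hasDerivAt

theorem HasVelocity.hasDerivAt_comp {γ : ℝ → M} {t : ℝ} {v : TangentSpace I (γ t)} {f : M → ℝ}
    (hf : MDifferentiableAt I 𝓘(ℝ, ℝ) f (γ t)) (hv : HasVelocity I γ t v) :
    HasDerivAt (fun s => f (γ s)) (mfderiv I 𝓘(ℝ, ℝ) f (γ t) v) t :=
  (hv.comp hf).hasDerivAt

/-- The derivative within `S` is only one of possibly many, but on the velocity of a curve that
stays in `S` its value is forced. Unique differentiability of `S` is therefore not needed, and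
closed submanifolds are allowed. -/
theorem HasVelocity.hasDerivAt_comp_within {γ : ℝ → M} {t : ℝ} {v : TangentSpace I (γ t)}
    {f : M → ℝ} {S : Set M} (hf : MDifferentiableWithinAt I 𝓘(ℝ, ℝ) f S (γ t))
    (hv : HasVelocity I γ t v) (hS : ∀ᶠ s in 𝓝 t, γ s ∈ S) :
    HasDerivAt (fun s => f (γ s)) (mfderivWithin I 𝓘(ℝ, ℝ) f S (γ t) v) t := by
  have h := (HasMFDerivWithinAt.comp t hf.hasMFDerivWithinAt hv.hasMFDerivWithinAt
    (s := γ ⁻¹' S) subset_rfl).hasMFDerivAt hS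
  refine HasVelocity.hasDerivAt (h.congr_mfderiv ?_)
  refine ContinuousLinearMap.ext_ring ?_
  change mfderivWithin I 𝓘(ℝ, ℝ) f S (γ t) ((1 : ℝ) • v) =
    (1 : ℝ) • (mfderivWithin I 𝓘(ℝ, ℝ) f S (γ t) v)
  rw [one_smul, one_smul]

/-- Smooth functions separate the tangent vectors at a point. -/
theorem eq_of_forall_mfderiv_eq [FiniteDimensional ℝ E] [IsManifold I ∞ M] [T2Space M]
    {x : M} {v w : TangentSpace I x}
    (h : ∀ f : M → ℝ, ContMDiff I 𝓘(ℝ, ℝ) ∞ f →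
      mfderiv I 𝓘(ℝ, ℝ) f x v = mfderiv I 𝓘(ℝ, ℝ) f x w) : v = w := by
  obtain ⟨χ⟩ : Nonempty (SmoothBumpFunction I x) := inferInstance
  have : IsManifold I 1 M := .of_le (n := ∞) (by norm_num)
  have hx := mem_extChartAt_source (I := I) x
  have hd : MDifferentiableAt I 𝓘(ℝ, E) (extChartAt I x) x :=
    (contMDiffAt_extChartAt (n := 1)).mdifferentiableAt (by simp)
  obtain ⟨e, he⟩ := isInvertible_mfderiv_extChartAt hx
  -- The chart has invertible derivative at `x`, so it is enough to compare images in `E` by linear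
  -- functionals.
  suffices hl : ∀ l : E →L[ℝ] ℝ, l (mfderiv I 𝓘(ℝ, E) (extChartAt I x) x v) =
      l (mfderiv I 𝓘(ℝ, E) (extChartAt I x) x w) by
    have hE := (SeparatingDual.eq_iff_forall_dual_eq (R := ℝ) (V := E)).2 hl
    rw [← he] at hE
    exact e.injective hE
  intro l
  -- The bump function makes the chart coordinate globally smooth without changing it near `x`.
  have hs : ContMDiff I 𝓘(ℝ, ℝ) ∞ (fun y => χ y • l (extChartAt I x y)) := by
    refine χ.contMDiff_smul ?_
    exact l.contMDiff.comp_contMDiffOn contMDiffOn_extChartAt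
  have hc : (fun y => χ y • l (extChartAt I x y)) =ᶠ[𝓝 x] l ∘ extChartAt I x := by
    filter_upwards [χ.eventuallyEq_one] with y hy
    simp [hy]
  have key := h _ hs
  rw [hc.mfderiv_eq] at key
  have hm := mfderiv_comp x (l.differentiableAt (x := extChartAt I x x)).mdifferentiableAt hd
  rw [hm] at key
  rw [mfderiv_eq_fderiv, ContinuousLinearMap.fderiv] at key
  exact key

end Velocity

/-! ### One-parameter subgroups and the exponential map -/

section OneParam

variable {E : Type*} [NormedAddCommGroup E] [NormedSpace ℝ E]
  {H : Type*} [TopologicalSpace H] {I : ModelWithCorners ℝ E H}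
  {G : Type*} [TopologicalSpace G] [ChartedSpace H G] [Group G]

theorem IsOneParam.hasVelocity_zero {γ : ℝ → G} {X : GroupLieAlgebra I G}
    (hγ : IsOneParam I γ X) : HasVelocity I γ 0 (X : E) :=
  hγ.2

variable [LieGroup I ∞ G]

variable (I) in
theorem mdifferentiableAt_mul_left (g x : G) : MDifferentiableAt I I (fun y : G => g * y) x :=
  (contMDiff_mul_left (n := ∞)).mdifferentiableAt (by simp)

variable (I) in
theorem mdifferentiableAt_mul_right (g x : G) : MDifferentiableAt I I (fun y : G => y * g) x :=
  (contMDiff_mul_right (n := ∞)).mdifferentiableAt (by simp)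

variable (I) in
theorem contMDiff_conj (g : G) : ContMDiff I I ∞ (fun x : G => g * x * g⁻¹) :=
  contMDiff_mul_right.comp contMDiff_mul_left

theorem IsOneParam.hasVelocity_mul_left {γ : ℝ → G} {X : GroupLieAlgebra I G}
    (hγ : IsOneParam I γ X) (g : G) :
    HasVelocity I (fun t => g * γ t) 0 (lmulVec I g X : E) := by
  have h0 : γ 0 = 1 := hγ.map_zero
  have h := hγ.hasVelocity_zero.comp (mdifferentiableAt_mul_left I g (γ 0))
  rw [h0] at h
  exact h

theorem IsOneParam.hasVelocity_mul_right {γ : ℝ → G} {X : GroupLieAlgebra I G}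
    (hγ : IsOneParam I γ X) (g : G) :
    HasVelocity I (fun t => γ t * g) 0 (rmulVec I X g : E) := by
  have h0 : γ 0 = 1 := hγ.map_zero
  have h := hγ.hasVelocity_zero.comp (mdifferentiableAt_mul_right I g (γ 0))
  rw [h0] at h
  exact h

theorem IsOneParam.conj {γ : ℝ → G} {X : GroupLieAlgebra I G} (hγ : IsOneParam I γ X) (g : G) :
    IsOneParam I (fun t => g * γ t * g⁻¹) (Ad I g X) := by
  refine ⟨fun s t => by simp [hγ.1], ?_⟩
  have h0 : γ 0 = 1 := hγ.map_zero
  have h := hγ.hasVelocity_zero.comp ((contMDiff_conj I g).mdifferentiableAt (by simp))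
  rw [h0] at h
  exact h

/-- Since `γ(s) = γ(t) γ(s - t)`, the velocity at `t` is the left translate by `γ(t)` of the
velocity at `0`. -/
theorem IsOneParam.isMIntegralCurve {γ : ℝ → G} {X : GroupLieAlgebra I G}
    (hγ : IsOneParam I γ X) : IsMIntegralCurve γ (mulInvariantVectorField X) := by
  intro t
  have h := hγ.hasVelocity_mul_left (γ t)
  have h2 : HasVelocity I (fun s => γ t * γ (s + -t)) t (lmulVec I (γ t) X : E) := by
    refine HasVelocity.comp_add_const (γ := fun s => γ t * γ s) (c := -t) ?_
    rw [add_neg_cancel]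
    exact h
  have e2 : (fun s => γ t * γ (s + -t)) = γ := by
    funext s
    rw [← hγ.1]
    simp
  rw [e2] at h2
  exact h2

theorem mfderiv_mul_left_mulInvariantVectorField (g h : G) (X : GroupLieAlgebra I G) :
    mfderiv I I (fun y : G => g * y) h (mulInvariantVectorField X h) =
      mulInvariantVectorField X (g * h) := by
  have e : (fun x : G => g * h * x) = (fun y : G => g * y) ∘ fun x => h * x := by
    funext x
    simp [mul_assoc]
  have h1 := mfderiv_comp_of_eq (x := (1 : G)) (y := h) (f := fun x : G => h * x)
    (g := fun y : G => g * y) (mdifferentiableAt_mul_left I g h)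
    (mdifferentiableAt_mul_left I h 1) (mul_one h)
  rw [← e] at h1
  -- The chain rule produces the base point `h * 1`; this moves the derivative from there to `h`.
  have h2 : ∀ k : G, k = h → ∀ v : E, (mfderiv I I (fun y : G => g * y) h : E →L[ℝ] E) v =
      (mfderiv I I (fun y : G => g * y) k : E →L[ℝ] E) v := by
    rintro _ rfl v
    rfl
  exact (h2 _ (mul_one h) _).trans (congrArg (fun L : E →L[ℝ] E => L X) h1).symm

theorem _root_.IsMIntegralCurveOn.mul_left {γ : ℝ → G} {X : GroupLieAlgebra I G} {s : Set ℝ}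
    (hs : IsOpen s) (hγ : IsMIntegralCurveOn γ (mulInvariantVectorField X) s) (g : G) :
    IsMIntegralCurveOn (fun t => g * γ t) (mulInvariantVectorField X) s := by
  intro t ht
  have h1 : HasVelocity I γ t (mulInvariantVectorField X (γ t)) :=
    (hγ t ht).hasMFDerivAt (hs.mem_nhds ht)
  have h2 := h1.comp (mdifferentiableAt_mul_left I g (γ t))
  rw [mfderiv_mul_left_mulInvariantVectorField] at h2
  exact h2.hasMFDerivWithinAt

theorem contMDiff_one_mulInvariantVectorField (X : GroupLieAlgebra I G) :
    ContMDiff I I.tangent 1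
      (fun g : G => (⟨g, mulInvariantVectorField X g⟩ : TangentBundle I G)) :=
  (contMDiff_mulInvariantVectorField X).of_le
    ((by norm_num : (1 : WithTop ℕ∞) ≤ 2).trans le_minSmoothness)

variable [T2Space G] [BoundarylessManifold I G]

theorem IsOneParam.eq {γ δ : ℝ → G} {X : GroupLieAlgebra I G}
    (hγ : IsOneParam I γ X) (hδ : IsOneParam I δ X) : γ = δ := by
  have : IsManifold I 1 G := .of_le (n := ∞) (by norm_num)
  exact isMIntegralCurve_Ioo_eq_of_contMDiff_boundaryless (t₀ := 0)
    (contMDiff_one_mulInvariantVectorField X) hγ.isMIntegralCurve hδ.isMIntegralCurve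
    (hγ.map_zero.trans hδ.map_zero.symm)

/-- The curves `t ↦ γ(t + s)` and `t ↦ γ(s) γ(t)` are integral curves of the same left-invariant
field and agree at `t = 0`, hence everywhere. -/
theorem isOneParam_of_isMIntegralCurve
    {γ : ℝ → G} {X : GroupLieAlgebra I G} (h0 : γ 0 = 1)
    (hγ : IsMIntegralCurve γ (mulInvariantVectorField X)) : IsOneParam I γ X := by
  have : IsManifold I 1 G := .of_le (n := ∞) (by norm_num)
  refine ⟨fun s t => ?_, ?_⟩
  · have h1 : IsMIntegralCurve (fun t => γ s * γ t) (mulInvariantVectorField X) :=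
      isMIntegralCurve_iff_isMIntegralCurveOn.2
        ((hγ.isMIntegralCurveOn _).mul_left isOpen_univ (γ s))
    have h2 := isMIntegralCurve_Ioo_eq_of_contMDiff_boundaryless (t₀ := 0)
      (contMDiff_one_mulInvariantVectorField X) (hγ.comp_add s) h1 (by simp [h0])
    simpa [add_comm] using congrFun h2 t
  · have h : HasVelocity I γ 0 (mulInvariantVectorField X (γ 0)) := hγ 0
    have hX : mulInvariantVectorField X (1 : G) = X := by
      have e : (fun x : G => 1 * x) = id := by
        funext x
        simp
      rw [mulInvariantVectorField, e, mfderiv_id]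
      rfl
    rw [h0, hX] at h
    exact h

/-- Left-invariant fields are complete: left translates of a local integral curve through `1` give
curves through every point with the same lifetime `ε`, and a uniform lifetime allows extension to
all of `ℝ`. -/
theorem exists_isOneParam [CompleteSpace E] (X : GroupLieAlgebra I G) :
    ∃ γ : ℝ → G, IsOneParam I γ X := by
  have : IsManifold I 1 G := .of_le (n := ∞) (by norm_num)
  have hc := contMDiff_one_mulInvariantVectorField X
  obtain ⟨γ, h0, hγ⟩ := exists_isMIntegralCurveAt_of_contMDiffAt_boundaryless 0
    (hc.contMDiffAt (x := (1 : G)))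
  obtain ⟨ε, hε, hγ⟩ := isMIntegralCurveAt_iff'.1 hγ
  rw [Real.ball_eq_Ioo, zero_sub, zero_add] at hγ
  obtain ⟨δ, hδ0, hδ⟩ := exists_isMIntegralCurve_of_isMIntegralCurveOn hc hε
    (fun x => ⟨fun t => x * γ t, by simp [h0], hγ.mul_left isOpen_Ioo x⟩) 1
  exact ⟨δ, isOneParam_of_isMIntegralCurve hδ0 hδ⟩

/-- The subgroup chosen inside `gexp` must be `s ↦ γ(t s)` by uniqueness. From here on any
one-parameter subgroup may replace the exponential. -/
theorem IsOneParam.gexp_smul {γ : ℝ → G} {X : GroupLieAlgebra I G} (hγ : IsOneParam I γ X)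
    (t : ℝ) : gexp I (t • X) = γ t := by
  have h := hγ.comp_mul I t
  have h2 : IsOneParam I _ (t • X) :=
    Classical.epsilon_spec (p := fun γ : ℝ → G => IsOneParam I γ (t • X)) ⟨_, h⟩
  have h3 := congrFun (h2.eq h) 1
  rw [mul_one] at h3
  exact h3

theorem IsOneParam.derR_eq {γ : ℝ → G} {X : GroupLieAlgebra I G} (hγ : IsOneParam I γ X)
    (f : G → ℝ) (g : G) : derR X f g = deriv (fun t => f (γ t * g)) 0 := by
  simp only [derR, hγ.gexp_smul]

theorem IsOneParam.derL_eq {γ : ℝ → G} {X : GroupLieAlgebra I G} (hγ : IsOneParam I γ X)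
    (f : G → ℝ) (g : G) : derL X f g = deriv (fun t => f (g * γ t)) 0 := by
  simp only [derL, hγ.gexp_smul]

variable [CompleteSpace E]

theorem derR_eq_mfderiv (X : GroupLieAlgebra I G) {f : G → ℝ} {g : G}
    (hf : MDifferentiableAt I 𝓘(ℝ, ℝ) f g) :
    derR X f g = mfderiv I 𝓘(ℝ, ℝ) f g (rmulVec I X g) := by
  obtain ⟨γ, hγ⟩ := exists_isOneParam X
  rw [hγ.derR_eq]
  have h := hγ.hasVelocity_mul_right g
  have e : γ 0 * g = g := by rw [hγ.map_zero, one_mul]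
  have hf' : MDifferentiableAt I 𝓘(ℝ, ℝ) f (γ 0 * g) := by rwa [e]
  have h2 := (HasVelocity.hasDerivAt_comp hf' h).deriv
  rw [e] at h2
  exact h2

theorem derL_eq_mfderiv (X : GroupLieAlgebra I G) {f : G → ℝ} {g : G}
    (hf : MDifferentiableAt I 𝓘(ℝ, ℝ) f g) :
    derL X f g = mfderiv I 𝓘(ℝ, ℝ) f g (lmulVec I g X) := by
  obtain ⟨γ, hγ⟩ := exists_isOneParam X
  rw [hγ.derL_eq]
  have h := hγ.hasVelocity_mul_left g
  have e : g * γ 0 = g := by rw [hγ.map_zero, mul_one]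
  have hf' : MDifferentiableAt I 𝓘(ℝ, ℝ) f (g * γ 0) := by rwa [e]
  have h2 := (HasVelocity.hasDerivAt_comp hf' h).deriv
  rw [e] at h2
  exact h2

end OneParam

/-! ### Definite forms -/

section DefiniteForms

variable {V : Type*} [AddCommGroup V] [Module ℝ V] [FiniteDimensional ℝ V]
  {B : LinearMap.BilinForm ℝ V}

/-- A definite form stays nondegenerate on every subspace, so the map from `W` to its dual is
injective, hence bijective by dimension. -/
theorem exists_mem_forall_mem_apply_eq (hneg : ∀ X, X ≠ 0 → B X X < 0) (W : Submodule ℝ V)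
    (L : V →ₗ[ℝ] ℝ) : ∃ v ∈ W, ∀ X ∈ W, B X v = L X := by
  let D : W →ₗ[ℝ] Module.Dual ℝ W := B.flip.compl₁₂ W.subtype W.subtype
  have hD : Function.Injective D := by
    rw [← LinearMap.ker_eq_bot, LinearMap.ker_eq_bot']
    intro v hv
    by_contra h
    have h1 : B v v = 0 := LinearMap.congr_fun hv v
    exact (hneg v (by simpa using h)).ne h1
  obtain ⟨v, hv⟩ := (LinearMap.injective_iff_surjective_of_finrank_eq_finrank
    (Subspace.dual_finrank_eq (K := ℝ) (V := W)).symm).1 hD (L ∘ₗ W.subtype)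
  exact ⟨v, v.2, fun X hX => LinearMap.congr_fun hv ⟨X, hX⟩⟩

omit [FiniteDimensional ℝ V] in
theorem eq_of_forall_mem_apply_eq (hneg : ∀ X, X ≠ 0 → B X X < 0) {W : Submodule ℝ V}
    {u v : V} (hu : u ∈ W) (hv : v ∈ W) (h : ∀ X ∈ W, B X u = B X v) : u = v := by
  by_contra hne
  have h1 := hneg (u - v) (sub_ne_zero.2 hne)
  have h2 := h (u - v) (W.sub_mem hu hv)
  rw [map_sub, h2, sub_self] at h1
  exact h1.false

-- The normalisation makes `B (e a) Z` minus the `a`-th coordinate of `Z`, which is the source of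
-- the sign.
omit [FiniteDimensional ℝ V] in
theorem sum_apply_mul_apply_of_basis {ι : Type*} [Fintype ι] [DecidableEq ι]
    (e : Module.Basis ι ℝ V)
    (he : ∀ a b, B (e a) (e b) = if a = b then -1 else 0) (X Y : V) :
    ∑ a, B (e a) X * B (e a) Y = -B X Y := by
  have h (a) (Z : V) : B (e a) Z = -e.repr Z a := by
    conv_lhs => rw [← e.sum_repr Z]
    simp [he, -Module.Basis.sum_repr]
  have h2 : B X Y = ∑ a, e.repr X a * B (e a) Y := by
    conv_lhs => rw [← e.sum_repr X]
    simp [-Module.Basis.sum_repr]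
  rw [h2, ← Finset.sum_neg_distrib]
  exact Finset.sum_congr rfl fun a _ => by rw [h a X, neg_mul]

/-- An isometry fixing `W` pointwise sends everything into the complement under `A - 1`. The kernel
of `A - 1` is `W`, which meets its complement trivially by definiteness, so `A - 1` is bijective
there. -/
theorem exists_mem_orthogonal_sub_eq (hneg : ∀ X, X ≠ 0 → B X X < 0) {A : V →ₗ[ℝ] V}
    (hA : ∀ X Y, B (A X) (A Y) = B X Y) {W : Submodule ℝ V} (hW : ∀ X, A X = X ↔ X ∈ W)
    {Z : V} (hZ : Z ∈ B.orthogonal W) : ∃ Y ∈ B.orthogonal W, A Y - Y = Z := by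
  have hmap : ∀ Y ∈ B.orthogonal W, (A - LinearMap.id : V →ₗ[ℝ] V) Y ∈ B.orthogonal W := by
    intro Y _ X hX
    change B X (A Y - Y) = 0
    have h := hA X Y
    rw [(hW X).2 hX] at h
    rw [map_sub, h, sub_self]
  let D : B.orthogonal W →ₗ[ℝ] B.orthogonal W := (A - LinearMap.id).restrict hmap
  have hD : Function.Injective D := by
    rw [← LinearMap.ker_eq_bot, LinearMap.ker_eq_bot']
    intro v hv
    have h1 : A v - v = 0 := congrArg Subtype.val hv
    have h2 : (v : V) ∈ W := (hW v).1 (sub_eq_zero.1 h1)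
    by_contra h
    exact (hneg v (by simpa using h)).ne (v.2 v h2)
  obtain ⟨Y, hY⟩ := LinearMap.injective_iff_surjective.1 hD ⟨Z, hZ⟩
  exact ⟨Y, Y.2, congrArg Subtype.val hY⟩

omit [FiniteDimensional ℝ V] in
/-- The Cayley transform `(A + 1) (A - 1)⁻¹` of an isometry is antisymmetric. -/
theorem apply_sub_cayley {A : V →ₗ[ℝ] V} (hA : ∀ X Y, B (A X) (A Y) = B X Y) (N Y : V) :
    B (A N - N) ((1 / 2 : ℝ) • (A Y + Y)) = -(1 / 2) * B (A N + N) (A Y - Y) := by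
  -- The terms `B N Y` and `B (A N) (A Y)` cancel, leaving `1/2 (B (A N) Y - B N (A Y))` on both
  -- sides.
  simp only [map_add, map_sub, map_smul, LinearMap.add_apply, LinearMap.sub_apply, hA,
    smul_eq_mul]
  ring

end DefiniteForms

/-! ### The adjoint action -/

section Adjoint

variable {E : Type*} [NormedAddCommGroup E] [NormedSpace ℝ E]
  {H : Type*} [TopologicalSpace H] {I : ModelWithCorners ℝ E H}
  {G : Type*} [TopologicalSpace G] [ChartedSpace H G] [Group G]

theorem IsOneParam.velocity_unique {γ : ℝ → G} {X Y : GroupLieAlgebra I G}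
    (hX : IsOneParam I γ X) (hY : IsOneParam I γ Y) : X = Y :=
  HasVelocity.unique hX.hasVelocity_zero hY.hasVelocity_zero

variable (I) in
/-- The adjoint action of `g` as a linear map. -/
def AdLin (g : G) : GroupLieAlgebra I G →ₗ[ℝ] GroupLieAlgebra I G :=
  ContinuousLinearMap.toLinearMap (M := E) (M₂ := E) (mfderiv I I (fun x : G => g * x * g⁻¹) 1)

theorem AdLin_apply (g : G) (X : GroupLieAlgebra I G) : AdLin I g X = Ad I g X := rfl

variable [LieGroup I ∞ G] [T2Space G] [BoundarylessManifold I G] [CompleteSpace E]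

theorem Ad_Ad_inv (g : G) (X : GroupLieAlgebra I G) : Ad I g (Ad I g⁻¹ X) = X := by
  obtain ⟨γ, hγ⟩ := exists_isOneParam X
  have h := (hγ.conj g⁻¹).conj g
  simp only [inv_inv, mul_assoc, mul_inv_cancel_left, mul_inv_cancel, mul_one] at h
  exact h.velocity_unique hγ

theorem Ad_inv_Ad (g : G) (X : GroupLieAlgebra I G) : Ad I g⁻¹ (Ad I g X) = X := by
  simpa using Ad_Ad_inv g⁻¹ X

/-- This is `γ(t) g = g (g⁻¹ γ(t) g)`, so it holds for every `f`, differentiable or not. -/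
theorem derR_eq_derL_Ad_inv (X : GroupLieAlgebra I G) (f : G → ℝ) (g : G) :
    derR X f g = derL (Ad I g⁻¹ X) f g := by
  obtain ⟨γ, hγ⟩ := exists_isOneParam X
  rw [hγ.derR_eq, (hγ.conj g⁻¹).derL_eq]
  simp [mul_assoc]

theorem mulInvariantVectorField_one (X : GroupLieAlgebra I G) :
    mulInvariantVectorField X (1 : G) = X := by
  obtain ⟨γ, hγ⟩ := exists_isOneParam X
  have h : HasVelocity I γ 0 (lmulVec I 1 X : E) := by
    have h1 := hγ.hasVelocity_mul_left 1
    have e : (fun t => 1 * γ t) = γ := by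
      funext t
      rw [one_mul]
    rwa [e] at h1
  exact HasVelocity.unique h hγ.hasVelocity_zero

/-- Conjugation is a homomorphism: it carries the curve `x γ(t)` to the conjugate of `x` times the
conjugate of `γ(t)`. Compare velocities at `0`. -/
theorem mfderiv_conj_mulInvariantVectorField (g x : G) (X : GroupLieAlgebra I G) :
    mfderiv I I (fun y : G => g * y * g⁻¹) x (mulInvariantVectorField X x) =
      mulInvariantVectorField (Ad I g X) (g * x * g⁻¹) := by
  obtain ⟨γ, hγ⟩ := exists_isOneParam X
  have h1 := (hγ.hasVelocity_mul_left x).comp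
    ((contMDiff_conj I g).mdifferentiableAt (by simp))
  have h2 := (hγ.conj g).hasVelocity_mul_left (g * x * g⁻¹)
  have e : (fun t => g * x * g⁻¹ * (g * γ t * g⁻¹)) =
      (fun y : G => g * y * g⁻¹) ∘ fun t => x * γ t := by
    funext t
    simp [mul_assoc]
  rw [e] at h2
  have e2 : x * γ 0 = x := by rw [hγ.map_zero, mul_one]
  rw [e2] at h1
  exact h1.unique h2

omit [T2Space G] [BoundarylessManifold I G] [CompleteSpace E] in
theorem isInvertible_mfderiv_conj (g x : G) :
    (mfderiv I I (fun y : G => g * y * g⁻¹) x).IsInvertible := by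
  have hd (a y : G) : MDifferentiableAt I I (fun y : G => a * y * a⁻¹) y :=
    (contMDiff_conj I a).mdifferentiableAt (by simp)
  have e1 : (fun y : G => g⁻¹ * y * g⁻¹⁻¹) ∘ (fun y : G => g * y * g⁻¹) = id := by
    funext y
    simp [mul_assoc]
  have e2 : (fun y : G => g * y * g⁻¹) ∘ (fun y : G => g⁻¹ * y * g⁻¹⁻¹) = id := by
    funext y
    simp [mul_assoc]
  have hx : g⁻¹ * (g * x * g⁻¹) * g⁻¹⁻¹ = x := congrFun e1 x
  have h1 := mfderiv_comp x (hd g⁻¹ (g * x * g⁻¹)) (hd g x)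
  have h2 := mfderiv_comp_of_eq (hd g x) (hd g⁻¹ (g * x * g⁻¹)) hx
  rw [e1, mfderiv_id] at h1
  rw [e2, mfderiv_id] at h2
  have h3 : ∀ k : G, k = x → (mfderiv I I (fun y : G => g * y * g⁻¹) x : E →L[ℝ] E) =
      mfderiv I I (fun y : G => g * y * g⁻¹) k := by
    rintro _ rfl
    rfl
  exact ContinuousLinearMap.IsInvertible.of_inverse (M := E) (M₂ := E)
    (g := mfderiv I I (fun y : G => g⁻¹ * y * g⁻¹⁻¹) (g * x * g⁻¹))
    ((congrArg (fun L : E →L[ℝ] E =>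
      L ∘L (mfderiv I I (fun y : G => g⁻¹ * y * g⁻¹⁻¹) (g * x * g⁻¹) : E →L[ℝ] E))
        (h3 _ hx)).trans h2.symm) h1.symm

theorem mpullback_conj_mulInvariantVectorField (g : G) (X : GroupLieAlgebra I G) :
    VectorField.mpullback I I (fun y : G => g * y * g⁻¹) (mulInvariantVectorField (Ad I g X)) =
      mulInvariantVectorField X := by
  funext x
  rw [VectorField.mpullback_apply, ← mfderiv_conj_mulInvariantVectorField]
  exact (isInvertible_mfderiv_conj g x).inverse_apply_self _

/-- The Lie bracket of vector fields is natural under pullback by conjugation, and this pullback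
permutes left-invariant fields according to the adjoint action. Invariance of the Killing form
follows. -/
theorem Ad_lie (g : G) (X Y : GroupLieAlgebra I G) : Ad I g ⁅X, Y⁆ = ⁅Ad I g X, Ad I g Y⁆ := by
  have h := VectorField.mpullback_mlieBracket (n := ∞) (I := I) (I' := I) (x₀ := (1 : G))
    (f := fun y : G => g * y * g⁻¹)
    (mdifferentiableAt_mulInvariantVectorField (Ad I g X))
    (mdifferentiableAt_mulInvariantVectorField (Ad I g Y))
    (contMDiff_conj I g).contMDiffAt
    (by rw [minSmoothness_of_isRCLikeNormedField]; exact ENat.LEInfty.out)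
  rw [mpullback_conj_mulInvariantVectorField, mpullback_conj_mulInvariantVectorField,
    ← mulInvariantVector_mlieBracket, ← GroupLieAlgebra.bracket_def,
    ← GroupLieAlgebra.bracket_def] at h
  -- The bracket is written as `Ad g` of a vector so that the pullback formula applies to it too.
  rw [← Ad_Ad_inv g ⁅Ad I g X, Ad I g Y⁆, mpullback_conj_mulInvariantVectorField,
    mulInvariantVectorField_one] at h
  rw [← h, Ad_Ad_inv]

variable (I) in
/-- The adjoint action of `g` as an automorphism of the Lie algebra. -/
def AdLieEquiv (g : G) : GroupLieAlgebra I G ≃ₗ⁅ℝ⁆ GroupLieAlgebra I G :=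
  { AdLin I g with
    map_lie' := fun {X Y} => Ad_lie g X Y
    invFun := Ad I g⁻¹
    left_inv := Ad_inv_Ad g
    right_inv := Ad_Ad_inv g }

theorem killingForm_Ad_Ad (g : G) (X Y : GroupLieAlgebra I G) :
    killingForm ℝ (GroupLieAlgebra I G) (Ad I g X) (Ad I g Y) =
      killingForm ℝ (GroupLieAlgebra I G) X Y :=
  LieAlgebra.killingForm_of_equiv_apply (AdLieEquiv I g) X Y

/-! ### Regular elements -/

-- The commutative group `T` lies in the centralizer of `Q`, which is itself a torus by regularity;
-- maximality of `T` forces equality.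
omit [ChartedSpace H G] [LieGroup I ∞ G] [T2Space G] in
theorem IsMaximalTorus.centralizer_eq {T : Subgroup G} (hT : IsMaximalTorus T) {Q : G}
    (hQ : Q ∈ T) (hreg : IsRegular Q) : Subgroup.centralizer {Q} = T := by
  refine (hT.eq_of_le hreg.prop fun x hx => ?_).symm
  rw [Subgroup.mem_centralizer_singleton_iff]
  exact hT.prop.2.2 _ hx _ hQ

/-- By uniqueness of one-parameter subgroups, `X` is fixed exactly when its subgroup commutes with
`Q`, that is, runs in the centralizer, which is `T`. -/
theorem Ad_eq_self_iff {T : Subgroup G} (hT : IsMaximalTorus T) {Q : G}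
    (hQ : Q ∈ T) (hreg : IsRegular Q) (X : GroupLieAlgebra I G) :
    Ad I Q X = X ↔ X ∈ torusAlgebra I T hT.prop := by
  constructor
  · intro h
    obtain ⟨γ, hγ⟩ := exists_isOneParam X
    refine ⟨γ, hγ, fun t => ?_⟩
    have h1 := hγ.conj Q
    rw [h] at h1
    have h2 := congrFun (h1.eq hγ) t
    rw [← hT.centralizer_eq hQ hreg, Subgroup.mem_centralizer_singleton_iff]
    exact (mul_inv_eq_iff_eq_mul.1 h2).symm
  · rintro ⟨γ, hγ, hγT⟩
    have h1 := hγ.conj Q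
    have e : (fun t => Q * γ t * Q⁻¹) = γ := by
      funext t
      rw [mul_inv_eq_iff_eq_mul]
      exact hT.prop.2.2 _ hQ _ (hγT t)
    rw [e] at h1
    exact h1.velocity_unique hγ

end Adjoint

/-! ### Gradients -/

section Gradients

variable {E : Type*} [NormedAddCommGroup E] [NormedSpace ℝ E]
  {H : Type*} [TopologicalSpace H] {I : ModelWithCorners ℝ E H}
  {G : Type*} [TopologicalSpace G] [ChartedSpace H G] [Group G]

theorem represent_zero {B : LinearMap.BilinForm ℝ (GroupLieAlgebra I G)}
    {W : Submodule ℝ (GroupLieAlgebra I G)} (hneg : ∀ X, X ≠ 0 → B X X < 0) :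
    represent B W (fun _ => 0) = 0 := by
  have h : represent B W (fun _ => 0) ∈ W ∧ ∀ X ∈ W, B X (represent B W fun _ => 0) = 0 :=
    Classical.epsilon_spec (p := fun v => v ∈ W ∧ ∀ X ∈ W, B X v = 0)
      ⟨0, W.zero_mem, fun X _ => map_zero _⟩
  exact eq_of_forall_mem_apply_eq hneg h.1 W.zero_mem fun X hX => by rw [h.2 X hX, map_zero]

/-- The points `exp(tX) g` and `g exp(tX)` are conjugate by `exp(tX)`, so the two functions of `t`
coincide. -/
theorem derR_eq_derL_of_isClassFunction {φ : G → ℝ} (hφ : IsClassFunction I φ)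
    (X : GroupLieAlgebra I G) (g : G) : derR X φ g = derL X φ g := by
  refine congrArg (fun u : ℝ → ℝ => deriv u 0) (funext fun t => ?_)
  simpa [mul_assoc] using hφ.2 (gexp I (t • X)) (g * gexp I (t • X))

theorem nabla'_eq_nabla_of_isClassFunction {B : LinearMap.BilinForm ℝ (GroupLieAlgebra I G)}
    {φ : G → ℝ} (hφ : IsClassFunction I φ) (g : G) : nabla' B φ g = nabla B φ g := by
  simp only [nabla, nabla', derR_eq_derL_of_isClassFunction hφ]

instance [FiniteDimensional ℝ E] : FiniteDimensional ℝ (GroupLieAlgebra I G) :=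
  inferInstanceAs (FiniteDimensional ℝ E)

variable [FiniteDimensional ℝ E] {B : LinearMap.BilinForm ℝ (GroupLieAlgebra I G)}
  {W : Submodule ℝ (GroupLieAlgebra I G)}

/-- Agreement with a linear functional is asked only on `W`, because a function smooth on a slice is
controlled only in torus directions of `Q`. -/
theorem represent_spec (hneg : ∀ X, X ≠ 0 → B X X < 0) {ℓ : GroupLieAlgebra I G → ℝ}
    (L : GroupLieAlgebra I G →ₗ[ℝ] ℝ) (hL : ∀ X ∈ W, ℓ X = L X) :
    represent B W ℓ ∈ W ∧ ∀ X ∈ W, B X (represent B W ℓ) = ℓ X := by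
  obtain ⟨v, hv, h⟩ := exists_mem_forall_mem_apply_eq hneg W L
  exact Classical.epsilon_spec (p := fun v => v ∈ W ∧ ∀ X ∈ W, B X v = ℓ X)
    ⟨v, hv, fun X hX => by rw [h X hX, hL X hX]⟩

theorem proj0_mem (hneg : ∀ X, X ≠ 0 → B X X < 0) (X : GroupLieAlgebra I G) :
    proj0 B W X ∈ W :=
  (represent_spec hneg (B.flip X) fun _ _ => rfl).1

theorem apply_proj0 (hneg : ∀ X, X ≠ 0 → B X X < 0) {Z : GroupLieAlgebra I G} (hZ : Z ∈ W)
    (X : GroupLieAlgebra I G) : B Z (proj0 B W X) = B Z X :=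
  (represent_spec hneg (B.flip X) fun _ _ => rfl).2 Z hZ

theorem projPerp_mem (hneg : ∀ X, X ≠ 0 → B X X < 0) (X : GroupLieAlgebra I G) :
    projPerp B W X ∈ B.orthogonal W := by
  intro Z hZ
  change B Z (X - proj0 B W X) = 0
  rw [map_sub, apply_proj0 hneg hZ, sub_self]

variable (I) in
/-- `X ↦ X g` as a linear map. -/
def rmulLin (g : G) : GroupLieAlgebra I G →ₗ[ℝ] TangentSpace I g :=
  ContinuousLinearMap.toLinearMap (M := E) (M₂ := E) (mfderiv I I (fun x : G => x * g) 1)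

variable (I) in
/-- `X ↦ g X` as a linear map. -/
def lmulLin (g : G) : GroupLieAlgebra I G →ₗ[ℝ] TangentSpace I g :=
  ContinuousLinearMap.toLinearMap (M := E) (M₂ := E) (mfderiv I I (fun x : G => g * x) 1)

omit [FiniteDimensional ℝ E] in
theorem rmulVec_neg (X : GroupLieAlgebra I G) (g : G) : rmulVec I (-X) g = -rmulVec I X g :=
  (rmulLin I g).map_neg X

omit [FiniteDimensional ℝ E] in
theorem lmulVec_neg (X : GroupLieAlgebra I G) (g : G) : lmulVec I g (-X) = -lmulVec I g X :=
  (lmulLin I g).map_neg X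

variable [LieGroup I ∞ G] [T2Space G] [BoundarylessManifold I G]

theorem apply_nabla (hneg : ∀ X, X ≠ 0 → B X X < 0) {f : G → ℝ} {g : G}
    (hf : MDifferentiableAt I 𝓘(ℝ, ℝ) f g) (X : GroupLieAlgebra I G) :
    B X (nabla B f g) = derR X f g := by
  have : CompleteSpace E := FiniteDimensional.complete ℝ E
  exact (represent_spec (W := ⊤) hneg
    ((mfderiv I 𝓘(ℝ, ℝ) f g : E →L[ℝ] ℝ).toLinearMap ∘ₗ rmulLin I g)
    fun Y _ => derR_eq_mfderiv Y hf).2 X trivial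

theorem apply_nabla' (hneg : ∀ X, X ≠ 0 → B X X < 0) {f : G → ℝ} {g : G}
    (hf : MDifferentiableAt I 𝓘(ℝ, ℝ) f g) (X : GroupLieAlgebra I G) :
    B X (nabla' B f g) = derL X f g := by
  have : CompleteSpace E := FiniteDimensional.complete ℝ E
  exact (represent_spec (W := ⊤) hneg
    ((mfderiv I 𝓘(ℝ, ℝ) f g : E →L[ℝ] ℝ).toLinearMap ∘ₗ lmulLin I g)
    fun Y _ => derL_eq_mfderiv Y hf).2 X trivial

/-- `∇f(g) = Ad_g ∇'f(g)`. -/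
theorem nabla_eq_Ad_nabla' (hneg : ∀ X, X ≠ 0 → B X X < 0)
    (hAd : ∀ (g : G) X Y, B (Ad I g X) (Ad I g Y) = B X Y) {f : G → ℝ} {g : G}
    (hf : MDifferentiableAt I 𝓘(ℝ, ℝ) f g) : nabla B f g = Ad I g (nabla' B f g) := by
  have : CompleteSpace E := FiniteDimensional.complete ℝ E
  refine eq_of_forall_mem_apply_eq (W := ⊤) hneg trivial trivial fun X _ => ?_
  rw [apply_nabla hneg hf, derR_eq_derL_Ad_inv, ← apply_nabla' hneg hf, ← hAd g, Ad_Ad_inv]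

/-! ### The r-matrix -/

variable {T : Subgroup G}

theorem invAdSubOne_spec (hneg : ∀ X, X ≠ 0 → B X X < 0)
    (hAd : ∀ (g : G) X Y, B (Ad I g X) (Ad I g Y) = B X Y) (hT : IsMaximalTorus T)
    (hW : W = torusAlgebra I T hT.prop) {Q : G} (hQ : Q ∈ T) (hreg : IsRegular Q)
    (Z : GroupLieAlgebra I G) :
    invAdSubOne B W Q Z ∈ B.orthogonal W ∧
      Ad I Q (invAdSubOne B W Q Z) - invAdSubOne B W Q Z = projPerp B W Z := by
  have : CompleteSpace E := FiniteDimensional.complete ℝ E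
  obtain ⟨Y, hY⟩ := exists_mem_orthogonal_sub_eq (A := AdLin I Q) hneg (hAd Q)
    (fun X => by rw [hW]; exact Ad_eq_self_iff hT hQ hreg X) (projPerp_mem (W := W) hneg Z)
  exact Classical.epsilon_spec
    (p := fun Y => Y ∈ B.orthogonal W ∧ Ad I Q Y - Y = projPerp B W Z) ⟨Y, hY⟩

/-- Symmetrised gradients in terms of the r-matrix. -/
theorem apply_nabla_add_nabla' (hs : ∀ X Y, B X Y = B Y X) (hneg : ∀ X, X ≠ 0 → B X X < 0)
    (hAd : ∀ (g : G) X Y, B (Ad I g X) (Ad I g Y) = B X Y) (hT : IsMaximalTorus T)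
    (hW : W = torusAlgebra I T hT.prop) {Q : G} (hQ : Q ∈ T) (hreg : IsRegular Q)
    {f : G → ℝ} (hf : MDifferentiableAt I 𝓘(ℝ, ℝ) f Q) (Z : GroupLieAlgebra I G) :
    -(1 / 2) * B (nabla B f Q + nabla' B f Q) Z =
      -B (nablaT B W f Q) Z + B (nabla B f Q - nabla' B f Q) (rMatrix B W Q Z) := by
  have : CompleteSpace E := FiniteDimensional.complete ℝ E
  obtain ⟨-, hY⟩ := invAdSubOne_spec hneg hAd hT hW hQ hreg Z
  have hc := apply_sub_cayley (A := AdLin I Q) (hAd Q) (nabla' B f Q) (invAdSubOne B W Q Z)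
  have hM := nabla_eq_Ad_nabla' hneg hAd hf
  have hfix : Ad I Q (proj0 B W Z) = proj0 B W Z := by
    rw [Ad_eq_self_iff hT hQ hreg, ← hW]
    exact proj0_mem hneg Z
  -- The two gradients differ by `Ad_Q`, an isometry fixing the torus component of `Z`.
  have hN : B (nabla' B f Q) (proj0 B W Z) = B (nabla B f Q) (proj0 B W Z) := by
    rw [hM, ← hAd Q, hfix]
  obtain ⟨(hm : nablaT B W f Q ∈ W), (hn : ∀ X ∈ W, B X (nablaT B W f Q) = derR X f Q)⟩ :=
    represent_spec (W := W) hneg (ℓ := fun X => derR X f Q)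
    (B.flip (nabla B f Q)) fun X _ => (apply_nabla hneg hf X).symm
  have hnT : B (nablaT B W f Q) Z = B (nabla B f Q) (proj0 B W Z) := by
    rw [← apply_proj0 hneg hm, hs, hn _ (proj0_mem hneg Z), hs, apply_nabla hneg hf]
  simp only [AdLin_apply, hY, ← hM] at hc
  -- With `Z = Z_0 + Z_⊥`, the Cayley identity accounts for `Z_⊥` and `hN` with `hnT` for `Z_0`.
  rw [rMatrix, hc, hnT, projPerp]
  simp only [map_add, map_sub, LinearMap.add_apply, hN]
  ring

end Gradients

/-! ### The quasi-Poisson bracket with a class function of one variable -/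

section Bracket

variable {E : Type*} [NormedAddCommGroup E] [NormedSpace ℝ E]
  {H : Type*} [TopologicalSpace H] {I : ModelWithCorners ℝ E H}
  {G : Type*} [TopologicalSpace G] [ChartedSpace H G] [Group G]

omit [Group G] in
theorem _root_.MDifferentiableAt.slice_fst {F : G × G → ℝ} {p : G × G}
    (hF : MDifferentiableAt (I.prod I) 𝓘(ℝ, ℝ) F p) :
    MDifferentiableAt I 𝓘(ℝ, ℝ) (fun x => F (x, p.2)) p.1 :=
  hF.comp p.1 (mdifferentiableAt_id.prodMk mdifferentiableAt_const)

omit [Group G] in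
theorem _root_.MDifferentiableAt.slice_snd {F : G × G → ℝ} {p : G × G}
    (hF : MDifferentiableAt (I.prod I) 𝓘(ℝ, ℝ) F p) :
    MDifferentiableAt I 𝓘(ℝ, ℝ) (fun x => F (p.1, x)) p.2 :=
  hF.comp p.2 (mdifferentiableAt_const.prodMk mdifferentiableAt_id)

theorem derR_const (X : GroupLieAlgebra I G) (c : ℝ) (g : G) :
    derR X (fun _ => c) g = 0 := by
  simp [derR]

theorem derL_const (X : GroupLieAlgebra I G) (c : ℝ) (g : G) :
    derL X (fun _ => c) g = 0 := by
  simp [derL]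

variable [LieGroup I ∞ G]

theorem HasVelocity.mul {α β : ℝ → G} {t : ℝ} {v : TangentSpace I (α t)}
    {w : TangentSpace I (β t)} (hα : HasVelocity I α t v) (hβ : HasVelocity I β t w) :
    HasVelocity I (fun s => α s * β s) t
      ((mfderiv I I (fun x : G => x * β t) (α t) v : E) +
        (mfderiv I I (fun x : G => α t * x) (β t) w : E)) := by
  have hm : MDifferentiableAt (I.prod I) I (fun p : G × G => p.1 * p.2) (α t, β t) :=
    (contMDiff_mul I ∞).mdifferentiableAt (by simp)
  have h := (hα.prodMk hβ).comp hm
  exact (congrArg (HasVelocity I (fun s => α s * β s) t)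
    (mfderiv_prod_eq_add_apply (v := ((v, w) : E × E)) hm)).mp h

/-- The velocity at `0` of the curve `γ(t) g γ(-t)`. -/
theorem IsOneParam.hasVelocity_conj {γ : ℝ → G} {X : GroupLieAlgebra I G}
    (hγ : IsOneParam I γ X) (g : G) :
    HasVelocity I (fun t => γ t * g * (γ t)⁻¹) 0
      ((rmulVec I X g : E) - (lmulVec I g X : E)) := by
  -- Writing the inverse as `γ(-t)` leaves only the product rule to apply.
  have hinv : (fun t => (γ t)⁻¹) = fun t => γ (-1 * t) := by
    funext t
    rw [inv_eq_iff_mul_eq_one, ← hγ.1]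
    simp [hγ.map_zero]
  have h := (hγ.hasVelocity_mul_right g).mul
    (hγ.comp_mul I (-1)).hasVelocity_zero
  have e1 : (fun x : G => x * γ (-1 * 0)) = id := by
    funext x
    simp [hγ.map_zero]
  have e2 : γ 0 * g = g := by rw [hγ.map_zero, one_mul]
  have e3 : γ (-1 * 0) = 1 := by rw [mul_zero, hγ.map_zero]
  rw [e1, mfderiv_id, e2, e3] at h
  have e4 : (fun t => γ t * g * (γ t)⁻¹) = fun t => γ t * g * γ (-1 * t) :=
    funext fun t => congrArg (γ t * g * ·) (congrFun hinv t)
  have e5 : (rmulVec I X g : E) - (lmulVec I g X : E) =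
      (rmulVec I X g : E) + (lmulVec I g ((-1 : ℝ) • X) : E) := by
    rw [sub_eq_add_neg, neg_one_smul]
    exact congrArg ((rmulVec I X g : E) + ·) (lmulVec_neg X g).symm
  rw [e4, e5]
  exact h

variable [T2Space G] [BoundarylessManifold I G] [CompleteSpace E]

/-- Differentiate the constant function `t ↦ F` along the simultaneous conjugation of `p` by `γ(t)`.
Only invariance at the point `p` enters. -/
theorem derR_sub_derL_eq_of_invariant {F : G × G → ℝ} {p : G × G}
    (hF : MDifferentiableAt (I.prod I) 𝓘(ℝ, ℝ) F p)
    (hinv : ∀ η : G, F (η * p.1 * η⁻¹, η * p.2 * η⁻¹) = F p) (X : GroupLieAlgebra I G) :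
    derR X (fun x => F (x, p.2)) p.1 - derL X (fun x => F (x, p.2)) p.1 =
      derL X (fun x => F (p.1, x)) p.2 - derR X (fun x => F (p.1, x)) p.2 := by
  obtain ⟨γ, hγ⟩ := exists_isOneParam X
  have h := (hγ.hasVelocity_conj p.1).prodMk (hγ.hasVelocity_conj p.2)
  have e : (γ 0 * p.1 * (γ 0)⁻¹, γ 0 * p.2 * (γ 0)⁻¹) = p := by simp [hγ.map_zero]
  have h1 := h.hasDerivAt_comp (f := F) (by rwa [e])
  simp only [hinv] at h1
  have h2 := h1.unique (hasDerivAt_const 0 (F p))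
  rw [e] at h2
  have h3 := (mfderiv_prod_eq_add_apply hF).symm.trans h2
  have h4 := (map_sub (mfderiv I 𝓘(ℝ, ℝ) (fun x => F (x, p.2)) p.1 : E →L[ℝ] ℝ)
    (rmulVec I X p.1) (lmulVec I p.1 X))
  have h5 := (map_sub (mfderiv I 𝓘(ℝ, ℝ) (fun x => F (p.1, x)) p.2 : E →L[ℝ] ℝ)
    (rmulVec I X p.2) (lmulVec I p.2 X))
  rw [derR_eq_mfderiv X hF.slice_fst, derL_eq_mfderiv X hF.slice_fst,
    derR_eq_mfderiv X hF.slice_snd, derL_eq_mfderiv X hF.slice_snd]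
  have h6 : ∀ a b c d : ℝ, a - b + (c - d) = 0 → a - b = d - c := fun a b c d h => by linarith
  exact h6 _ _ _ _ ((congrArg₂ (fun a b : ℝ => a + b) h4 h5).symm.trans h3)

variable {ι : Type*} [Fintype ι]

theorem qpBracket_comp_snd {F : G × G → ℝ} {p : G × G}
    (hF : MDifferentiableAt (I.prod I) 𝓘(ℝ, ℝ) F p)
    (hinv : ∀ η : G, F (η * p.1 * η⁻¹, η * p.2 * η⁻¹) = F p)
    {φ : G → ℝ} (hφ : IsClassFunction I φ) (e : ι → GroupLieAlgebra I G) :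
    qpBracket e F (fun q => φ q.2) p =
      (1 / 2) * ∑ a, (derR (e a) (fun x => F (x, p.2)) p.1 +
        derL (e a) (fun x => F (x, p.2)) p.1) * derR (e a) φ p.2 := by
  refine congrArg ((1 / 2 : ℝ) * ·) (Finset.sum_congr rfl fun a _ => ?_)
  have h := derR_sub_derL_eq_of_invariant hF hinv (e a)
  simp only [wedge, vecL₁, vecL₂, vecR₁, vecR₂, derR_const, derL_const,
    ← derR_eq_derL_of_isClassFunction hφ]
  -- The wedge terms add up to `(2 L_1 + L_2 - R_2) r`; invariance replaces `L_2 - R_2` by `R_1 -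
  -- L_1`.
  linear_combination -derR (e a) φ p.2 * h

theorem qpBracket_comp_fst {F : G × G → ℝ} {p : G × G}
    (hF : MDifferentiableAt (I.prod I) 𝓘(ℝ, ℝ) F p)
    (hinv : ∀ η : G, F (η * p.1 * η⁻¹, η * p.2 * η⁻¹) = F p)
    {φ : G → ℝ} (hφ : IsClassFunction I φ) (e : ι → GroupLieAlgebra I G) :
    qpBracket e F (fun q => φ q.1) p =
      -((1 / 2) * ∑ a, (derR (e a) (fun x => F (p.1, x)) p.2 +
        derL (e a) (fun x => F (p.1, x)) p.2) * derR (e a) φ p.1) := by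
  rw [qpBracket, ← mul_neg, ← Finset.sum_neg_distrib]
  refine congrArg ((1 / 2 : ℝ) * ·) (Finset.sum_congr rfl fun a _ => ?_)
  have h := derR_sub_derL_eq_of_invariant hF hinv (e a)
  simp only [wedge, vecL₁, vecL₂, vecR₁, vecR₂, derR_const, derL_const,
    ← derR_eq_derL_of_isClassFunction hφ]
  -- Here the wedge terms add up to `(R_1 - L_1 - 2 L_2) r`, which invariance turns into `-(R_2 +
  -- L_2) r`.
  linear_combination derR (e a) φ p.1 * h

end Bracket

/-! ### The quasi-Poisson bracket restricted to the slices -/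

section BracketOnSlice

variable {E : Type*} [NormedAddCommGroup E] [NormedSpace ℝ E] [FiniteDimensional ℝ E]
  {H : Type*} [TopologicalSpace H] {I : ModelWithCorners ℝ E H}
  {G : Type*} [TopologicalSpace G] [ChartedSpace H G] [Group G] [LieGroup I ∞ G] [T2Space G]
  [BoundarylessManifold I G] {B : LinearMap.BilinForm ℝ (GroupLieAlgebra I G)}
  {W : Submodule ℝ (GroupLieAlgebra I G)} {T : Subgroup G}
  {ι : Type*} [Fintype ι] [DecidableEq ι]

theorem sum_derR_add_derL_mul (hneg : ∀ X, X ≠ 0 → B X X < 0)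
    (e : Module.Basis ι ℝ (GroupLieAlgebra I G))
    (he : ∀ a b, B (e a) (e b) = if a = b then -1 else 0) {f φ : G → ℝ} {Q g : G}
    (hf : MDifferentiableAt I 𝓘(ℝ, ℝ) f Q) (hφ : MDifferentiableAt I 𝓘(ℝ, ℝ) φ g) :
    ∑ a, (derR (e a) f Q + derL (e a) f Q) * derR (e a) φ g =
      -B (nabla B f Q + nabla' B f Q) (nabla B φ g) := by
  rw [← sum_apply_mul_apply_of_basis e he]
  refine Finset.sum_congr rfl fun a _ => ?_
  rw [map_add, apply_nabla hneg hf, apply_nabla' hneg hf, apply_nabla hneg hφ]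

theorem nabla_sub_nabla'_of_invariant (hneg : ∀ X, X ≠ 0 → B X X < 0) {F : G × G → ℝ}
    {p : G × G} (hF : MDifferentiableAt (I.prod I) 𝓘(ℝ, ℝ) F p)
    (hinv : ∀ η : G, F (η * p.1 * η⁻¹, η * p.2 * η⁻¹) = F p) :
    nabla₁ B F p - nabla₁' B F p = nabla₂' B F p - nabla₂ B F p := by
  have : CompleteSpace E := FiniteDimensional.complete ℝ E
  refine eq_of_forall_mem_apply_eq (W := ⊤) hneg trivial trivial fun X _ => ?_
  rw [map_sub, map_sub, nabla₁, nabla₁', nabla₂, nabla₂', apply_nabla hneg hF.slice_fst,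
    apply_nabla' hneg hF.slice_fst, apply_nabla hneg hF.slice_snd,
    apply_nabla' hneg hF.slice_snd, derR_sub_derL_eq_of_invariant hF hinv]

theorem qpBracket_comp_snd_eq (hs : ∀ X Y, B X Y = B Y X) (hneg : ∀ X, X ≠ 0 → B X X < 0)
    (hAd : ∀ (g : G) X Y, B (Ad I g X) (Ad I g Y) = B X Y)
    (e : Module.Basis ι ℝ (GroupLieAlgebra I G))
    (he : ∀ a b, B (e a) (e b) = if a = b then -1 else 0)
    (hT : IsMaximalTorus T) (hW : W = torusAlgebra I T hT.prop)
    {φ : G → ℝ} (hφ : IsClassFunction I φ) {F : G × G → ℝ}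
    (hF : IsSmoothInvariantOn I regSet₁ F) {p : G × G} (hp : p ∈ slice₁ T) :
    qpBracket e F (fun q => φ q.2) p =
      - B (nablaT₁ B W F p) (nabla B φ p.2)
        + B (nabla₂' B F p - nabla₂ B F p) (rMatrix B W p.1 (nabla B φ p.2)) := by
  have : CompleteSpace E := FiniteDimensional.complete ℝ E
  have hd : MDifferentiableAt (I.prod I) 𝓘(ℝ, ℝ) F p := (hF.1 p hp.2).mdifferentiableAt (by simp)
  -- Invariance is used twice: to simplify the bracket, and to move the gradient difference to the
  -- variable `Q`, where the r-matrix identity lives.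
  rw [qpBracket_comp_snd hd (hF.2 p hp.2) hφ, ← nabla_sub_nabla'_of_invariant hneg hd (hF.2 p hp.2),
    sum_derR_add_derL_mul hneg e he hd.slice_fst (hφ.1.mdifferentiableAt (by simp)), nablaT₁,
    nabla₁, nabla₁', ← apply_nabla_add_nabla' hs hneg hAd hT hW hp.1 hp.2 hd.slice_fst]
  ring

theorem qpBracket_comp_fst_eq (hs : ∀ X Y, B X Y = B Y X) (hneg : ∀ X, X ≠ 0 → B X X < 0)
    (hAd : ∀ (g : G) X Y, B (Ad I g X) (Ad I g Y) = B X Y)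
    (e : Module.Basis ι ℝ (GroupLieAlgebra I G))
    (he : ∀ a b, B (e a) (e b) = if a = b then -1 else 0)
    (hT : IsMaximalTorus T) (hW : W = torusAlgebra I T hT.prop)
    {φ : G → ℝ} (hφ : IsClassFunction I φ) {F : G × G → ℝ}
    (hF : IsSmoothInvariantOn I regSet₂ F) {p : G × G} (hp : p ∈ slice₂ T) :
    qpBracket e F (fun q => φ q.1) p =
      B (nablaT₂ B W F p) (nabla B φ p.1)
        - B (nabla₁' B F p - nabla₁ B F p) (rMatrix B W p.2 (nabla B φ p.1)) := by
  have : CompleteSpace E := FiniteDimensional.complete ℝ E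
  have hd : MDifferentiableAt (I.prod I) 𝓘(ℝ, ℝ) F p := (hF.1 p hp.2).mdifferentiableAt (by simp)
  have h := nabla_sub_nabla'_of_invariant hneg hd (hF.2 p hp.2)
  have h2 := apply_nabla_add_nabla' hs hneg hAd hT hW hp.1 hp.2 hd.slice_snd (nabla B φ p.1)
  rw [← neg_sub (nabla₁ B F p), h, neg_sub, qpBracket_comp_fst hd (hF.2 p hp.2) hφ,
    sum_derR_add_derL_mul hneg e he hd.slice_snd (hφ.1.mdifferentiableAt (by simp))]
  rw [nablaT₂, nabla₂, nabla₂']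
  linear_combination -h2

/-! ### The reduced brackets with a class function of one variable -/

-- The Hamiltonian is constant in `Q` and its two gradients in `g` coincide; no property of `F` is
-- needed.
omit [FiniteDimensional ℝ E] [LieGroup I ∞ G] [T2Space G] [BoundarylessManifold I G] in
theorem redBracket₁_comp_snd (hneg : ∀ X, X ≠ 0 → B X X < 0) {φ : G → ℝ}
    (hφ : IsClassFunction I φ) (F : G × G → ℝ) (p : G × G) :
    redBracket₁ B W F (fun q => φ q.2) p =
      - B (nablaT₁ B W F p) (nabla B φ p.2)
        + B (nabla₂' B F p - nabla₂ B F p) (rMatrix B W p.1 (nabla B φ p.2)) := by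
  have h0 : nablaT₁ B W (fun q : G × G => φ q.2) p = 0 := by
    simp only [nablaT₁, nablaT, derR_const, represent_zero hneg]
  have h1 : nabla₂' B (fun q : G × G => φ q.2) p = nabla B φ p.2 :=
    nabla'_eq_nabla_of_isClassFunction hφ p.2
  have h2 : nabla₂ B (fun q : G × G => φ q.2) p = nabla B φ p.2 := rfl
  rw [redBracket₁, h0, h1, h2, map_sub, map_zero, LinearMap.sub_apply, LinearMap.zero_apply]
  ring

omit [FiniteDimensional ℝ E] [LieGroup I ∞ G] [T2Space G] [BoundarylessManifold I G] in
theorem redBracket₂_comp_fst (hneg : ∀ X, X ≠ 0 → B X X < 0) {φ : G → ℝ}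
    (hφ : IsClassFunction I φ) (F : G × G → ℝ) (p : G × G) :
    redBracket₂ B W F (fun q => φ q.1) p =
      B (nablaT₂ B W F p) (nabla B φ p.1)
        - B (nabla₁' B F p - nabla₁ B F p) (rMatrix B W p.2 (nabla B φ p.1)) := by
  have h0 : nablaT₂ B W (fun q : G × G => φ q.1) p = 0 := by
    simp only [nablaT₂, nablaT, derR_const, represent_zero hneg]
  have h1 : nabla₁' B (fun q : G × G => φ q.1) p = nabla B φ p.1 :=
    nabla'_eq_nabla_of_isClassFunction hφ p.1
  have h2 : nabla₁ B (fun q : G × G => φ q.1) p = nabla B φ p.1 := rfl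
  rw [redBracket₂, h0, h1, h2, map_sub, map_zero, LinearMap.sub_apply, LinearMap.zero_apply]
  ring

end BracketOnSlice

/-! ### Derivatives along the slices -/

section SliceDerivative

variable {E : Type*} [NormedAddCommGroup E] [NormedSpace ℝ E]
  {H : Type*} [TopologicalSpace H] {I : ModelWithCorners ℝ E H}
  {G : Type*} [TopologicalSpace G] [ChartedSpace H G] [Group G] {T : Subgroup G}

variable (I) in
/-- The derivative of the function `f` along the tangent vector `v`. -/
def dirDeriv (f : G → ℝ) (g : G) (v : TangentSpace I g) : ℝ := mfderiv I 𝓘(ℝ, ℝ) f g v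

omit [Group G] in
theorem _root_.HasMFDerivAt.dirDeriv_eq {f : G → ℝ} {g : G} {L : E →L[ℝ] ℝ}
    (h : HasMFDerivAt I 𝓘(ℝ, ℝ) f g L) (v : TangentSpace I g) : dirDeriv I f g v = L v :=
  congrArg (fun L : E →L[ℝ] ℝ => L v) h.mfderiv

omit [Group G] in
theorem dirDeriv_const (c : ℝ) (g : G) (v : TangentSpace I g) :
    dirDeriv I (fun _ : G => c) g v = 0 :=
  (hasMFDerivAt_const c g).dirDeriv_eq (L := 0) v

omit [Group G] in
theorem eq_of_forall_dirDeriv_eq [FiniteDimensional ℝ E] [IsManifold I ∞ G] [T2Space G] {g : G}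
    {v w : TangentSpace I g} (h : ∀ f : G → ℝ, ContMDiff I 𝓘(ℝ, ℝ) ∞ f →
      dirDeriv I f g v = dirDeriv I f g w) : v = w :=
  eq_of_forall_mfderiv_eq h

omit [Group G] in
theorem HasVelocity.const (g : G) (t : ℝ) : HasVelocity I (fun _ => g) t (0 : E) := by
  refine (hasMFDerivAt_const g t).congr_mfderiv (ContinuousLinearMap.ext_ring ?_)
  change (0 : E) = (1 : ℝ) • (0 : E)
  simp

/-- With the first entry fixed in `T`, the whole of `G` embeds in the slice manifold, so the
derivative within it restricts to an ordinary one. -/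
theorem hasMFDerivAt_slice_snd {F : G × G → ℝ} {p : G × G} (hp : p.1 ∈ T)
    (hF : MDifferentiableWithinAt (I.prod I) 𝓘(ℝ, ℝ) F {q | q.1 ∈ T} p) :
    HasMFDerivAt I 𝓘(ℝ, ℝ) (fun x => F (p.1, x)) p.2
      ((mfderivWithin (I.prod I) 𝓘(ℝ, ℝ) F {q | q.1 ∈ T} p : E × E →L[ℝ] ℝ) ∘L
        ContinuousLinearMap.inr ℝ E E) := by
  have h : HasMFDerivWithinAt I (I.prod I) (fun x : G => (p.1, x)) Set.univ p.2
      (ContinuousLinearMap.inr ℝ E E) :=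
    ((hasMFDerivAt_const p.1 p.2).prodMk (hasMFDerivAt_id p.2)).hasMFDerivWithinAt
  exact hasMFDerivWithinAt_univ.1
    (HasMFDerivWithinAt.comp p.2 hF.hasMFDerivWithinAt h fun _ _ => hp)

theorem hasMFDerivAt_slice_fst {F : G × G → ℝ} {p : G × G} (hp : p.2 ∈ T)
    (hF : MDifferentiableWithinAt (I.prod I) 𝓘(ℝ, ℝ) F {q | q.2 ∈ T} p) :
    HasMFDerivAt I 𝓘(ℝ, ℝ) (fun x => F (x, p.2)) p.1
      ((mfderivWithin (I.prod I) 𝓘(ℝ, ℝ) F {q | q.2 ∈ T} p : E × E →L[ℝ] ℝ) ∘L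
        ContinuousLinearMap.inl ℝ E E) := by
  have h : HasMFDerivWithinAt I (I.prod I) (fun x : G => (x, p.2)) Set.univ p.1
      (ContinuousLinearMap.inl ℝ E E) :=
    ((hasMFDerivAt_id p.1).prodMk (hasMFDerivAt_const p.2 p.1)).hasMFDerivWithinAt
  exact hasMFDerivWithinAt_univ.1
    (HasMFDerivWithinAt.comp p.1 hF.hasMFDerivWithinAt h fun _ _ => hp)

variable [LieGroup I ∞ G] [T2Space G] [BoundarylessManifold I G]

/-- The one-parameter subgroup of `X` runs in `T`, so the curve `γ(t) Q` never leaves the torus and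
determines the derivative within it. -/
theorem derR_fst_eq_sliceDeriv₁ {F : G × G → ℝ} {p : G × G} (hp : p.1 ∈ T)
    (hF : MDifferentiableWithinAt (I.prod I) 𝓘(ℝ, ℝ) F {q | q.1 ∈ T} p)
    {hT : IsTorus T} {X : GroupLieAlgebra I G} (hX : X ∈ torusAlgebra I T hT) :
    derR X (fun x => F (x, p.2)) p.1 =
      sliceDeriv₁ I T F p (((rmulVec I X p.1 : E), (0 : E)) : E × E) := by
  obtain ⟨γ, hγ, hγT⟩ := hX
  rw [hγ.derR_eq]
  have h := (hγ.hasVelocity_mul_right p.1).prodMk (HasVelocity.const (I := I) p.2 0)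
  have e : (γ 0 * p.1, p.2) = p := by rw [hγ.map_zero, one_mul]
  have h2 := (h.hasDerivAt_comp_within (f := F) (S := {q | q.1 ∈ T}) (by rwa [e])
    (.of_forall fun t => T.mul_mem (hγT t) hp)).deriv
  rw [e] at h2
  exact h2

theorem derR_snd_eq_sliceDeriv₂ {F : G × G → ℝ} {p : G × G} (hp : p.2 ∈ T)
    (hF : MDifferentiableWithinAt (I.prod I) 𝓘(ℝ, ℝ) F {q | q.2 ∈ T} p)
    {hT : IsTorus T} {X : GroupLieAlgebra I G} (hX : X ∈ torusAlgebra I T hT) :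
    derR X (fun x => F (p.1, x)) p.2 =
      sliceDeriv₂ I T F p (((0 : E), (rmulVec I X p.2 : E)) : E × E) := by
  obtain ⟨γ, hγ, hγT⟩ := hX
  rw [hγ.derR_eq]
  have h := (HasVelocity.const (I := I) p.1 0).prodMk (hγ.hasVelocity_mul_right p.2)
  have e : (p.1, γ 0 * p.2) = p := by rw [hγ.map_zero, one_mul]
  have h2 := (h.hasDerivAt_comp_within (f := F) (S := {q | q.2 ∈ T}) (by rwa [e])
    (.of_forall fun t => T.mul_mem (hγT t) hp)).deriv
  rw [e] at h2
  exact h2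

theorem sliceDeriv₁_apply {F : G × G → ℝ} {p : G × G} (hp : p.1 ∈ T)
    (hF : MDifferentiableWithinAt (I.prod I) 𝓘(ℝ, ℝ) F {q | q.1 ∈ T} p)
    {hT : IsTorus T} {X : GroupLieAlgebra I G} (hX : X ∈ torusAlgebra I T hT)
    {w : TangentSpace (I.prod I) p} (hw : w.1 = rmulVec I X p.1) :
    sliceDeriv₁ I T F p w = derR X (fun x => F (x, p.2)) p.1 +
      dirDeriv I (fun x => F (p.1, x)) p.2 w.2 := by
  have e (L : E × E →L[ℝ] ℝ) (a b : E) : L (a, b) = L (a, 0) + L (0, b) := by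
    rw [← map_add]
    simp
  exact (congrArg (mfderivWithin (I.prod I) 𝓘(ℝ, ℝ) F {q | q.1 ∈ T} p : E × E →L[ℝ] ℝ)
    (Prod.ext hw rfl : (w : E × E) = ((rmulVec I X p.1 : E), (w.2 : E)))).trans
    ((e _ _ _).trans (congrArg₂ (· + ·) (derR_fst_eq_sliceDeriv₁ hp hF hX).symm
      ((hasMFDerivAt_slice_snd hp hF).dirDeriv_eq _).symm))

theorem sliceDeriv₂_apply {F : G × G → ℝ} {p : G × G} (hp : p.2 ∈ T)
    (hF : MDifferentiableWithinAt (I.prod I) 𝓘(ℝ, ℝ) F {q | q.2 ∈ T} p)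
    {hT : IsTorus T} {X : GroupLieAlgebra I G} (hX : X ∈ torusAlgebra I T hT)
    {w : TangentSpace (I.prod I) p} (hw : w.2 = rmulVec I X p.2) :
    sliceDeriv₂ I T F p w = derR X (fun x => F (p.1, x)) p.2 +
      dirDeriv I (fun x => F (x, p.2)) p.1 w.1 := by
  have e (L : E × E →L[ℝ] ℝ) (a b : E) : L (a, b) = L (0, b) + L (a, 0) := by
    rw [← map_add]
    simp
  exact (congrArg (mfderivWithin (I.prod I) 𝓘(ℝ, ℝ) F {q | q.2 ∈ T} p : E × E →L[ℝ] ℝ)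
    (Prod.ext rfl hw : (w : E × E) = ((w.1 : E), (rmulVec I X p.2 : E)))).trans
    ((e _ _ _).trans (congrArg₂ (· + ·) (derR_snd_eq_sliceDeriv₂ hp hF hX).symm
      ((hasMFDerivAt_slice_fst hp hF).dirDeriv_eq _).symm))

omit [LieGroup I ∞ G] [T2Space G] [BoundarylessManifold I G] in
theorem IsSmoothSlice₁.mdifferentiableWithinAt {F : G × G → ℝ} (hF : IsSmoothSlice₁ I T F)
    {p : G × G} (hp : p ∈ slice₁ T) :
    MDifferentiableWithinAt (I.prod I) 𝓘(ℝ, ℝ) F {q | q.1 ∈ T} p :=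
  (hF p hp).mdifferentiableWithinAt (by simp)

omit [LieGroup I ∞ G] [T2Space G] [BoundarylessManifold I G] in
theorem IsSmoothSlice₂.mdifferentiableWithinAt {F : G × G → ℝ} (hF : IsSmoothSlice₂ I T F)
    {p : G × G} (hp : p ∈ slice₂ T) :
    MDifferentiableWithinAt (I.prod I) 𝓘(ℝ, ℝ) F {q | q.2 ∈ T} p :=
  (hF p hp).mdifferentiableWithinAt (by simp)

omit [LieGroup I ∞ G] [T2Space G] [BoundarylessManifold I G] in
theorem _root_.ContMDiff.isSmoothSlice₁ {F : G × G → ℝ}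
    (hF : ContMDiff (I.prod I) 𝓘(ℝ, ℝ) ∞ F) (T : Subgroup G) : IsSmoothSlice₁ I T F :=
  fun _ _ => hF.contMDiffAt.contMDiffWithinAt

omit [LieGroup I ∞ G] [T2Space G] [BoundarylessManifold I G] in
theorem _root_.ContMDiff.isSmoothSlice₂ {F : G × G → ℝ}
    (hF : ContMDiff (I.prod I) 𝓘(ℝ, ℝ) ∞ F) (T : Subgroup G) : IsSmoothSlice₂ I T F :=
  fun _ _ => hF.contMDiffAt.contMDiffWithinAt

variable [FiniteDimensional ℝ E] {B : LinearMap.BilinForm ℝ (GroupLieAlgebra I G)}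
  {W : Submodule ℝ (GroupLieAlgebra I G)}

/-- The torus gradient lies in `W`, so it sees only the component `Z_0`. This is why `Q` moves along
the torus part of `∇φ`. -/
theorem apply_nablaT₁ (hneg : ∀ X, X ≠ 0 → B X X < 0) {hT : IsTorus T}
    (hW : W = torusAlgebra I T hT) {F : G × G → ℝ} {p : G × G} (hp : p.1 ∈ T)
    (hF : MDifferentiableWithinAt (I.prod I) 𝓘(ℝ, ℝ) F {q | q.1 ∈ T} p)
    (hs : ∀ X Y, B X Y = B Y X) (Z : GroupLieAlgebra I G) :
    B (nablaT₁ B W F p) Z = derR (proj0 B W Z) (fun x => F (x, p.2)) p.1 := by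
  obtain ⟨(h1 : nablaT₁ B W F p ∈ W), (h2 : ∀ X ∈ W, B X (nablaT₁ B W F p) = _)⟩ :=
    represent_spec (W := W) hneg (ℓ := fun X => derR X (fun x => F (x, p.2)) p.1)
      ((mfderivWithin (I.prod I) 𝓘(ℝ, ℝ) F {q | q.1 ∈ T} p : E × E →L[ℝ] ℝ).toLinearMap ∘ₗ
        LinearMap.inl ℝ E E ∘ₗ rmulLin I p.1)
      fun X hX => derR_fst_eq_sliceDeriv₁ hp hF (hT := hT) (by rwa [← hW])
  rw [← apply_proj0 hneg h1, hs, h2 _ (proj0_mem hneg Z)]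

theorem apply_nablaT₂ (hneg : ∀ X, X ≠ 0 → B X X < 0) {hT : IsTorus T}
    (hW : W = torusAlgebra I T hT) {F : G × G → ℝ} {p : G × G} (hp : p.2 ∈ T)
    (hF : MDifferentiableWithinAt (I.prod I) 𝓘(ℝ, ℝ) F {q | q.2 ∈ T} p)
    (hs : ∀ X Y, B X Y = B Y X) (Z : GroupLieAlgebra I G) :
    B (nablaT₂ B W F p) Z = derR (proj0 B W Z) (fun x => F (p.1, x)) p.2 := by
  obtain ⟨(h1 : nablaT₂ B W F p ∈ W), (h2 : ∀ X ∈ W, B X (nablaT₂ B W F p) = _)⟩ :=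
    represent_spec (W := W) hneg (ℓ := fun X => derR X (fun x => F (p.1, x)) p.2)
      ((mfderivWithin (I.prod I) 𝓘(ℝ, ℝ) F {q | q.2 ∈ T} p : E × E →L[ℝ] ℝ).toLinearMap ∘ₗ
        LinearMap.inr ℝ E E ∘ₗ rmulLin I p.2)
      fun X hX => derR_snd_eq_sliceDeriv₂ hp hF (hT := hT) (by rwa [← hW])
  rw [← apply_proj0 hneg h1, hs, h2 _ (proj0_mem hneg Z)]

/-- With `Z` the r-matrix applied to `∇φ`, this produces the commutator in the equation for `g`. -/
theorem apply_nabla'_sub_nabla (hs : ∀ X Y, B X Y = B Y X) (hneg : ∀ X, X ≠ 0 → B X X < 0)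
    {f : G → ℝ} {g : G} (hf : MDifferentiableAt I 𝓘(ℝ, ℝ) f g) (Z : GroupLieAlgebra I G) :
    B (nabla' B f g - nabla B f g) Z =
      dirDeriv I f g (commVec I g Z) := by
  have : CompleteSpace E := FiniteDimensional.complete ℝ E
  rw [hs, map_sub, apply_nabla hneg hf, apply_nabla' hneg hf, derR_eq_mfderiv Z hf,
    derL_eq_mfderiv Z hf]
  exact (map_sub (mfderiv I 𝓘(ℝ, ℝ) f g : E →L[ℝ] ℝ) _ _).symm

theorem derR_neg {f : G → ℝ} (X : GroupLieAlgebra I G) (g : G) :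
    derR (-X) f g = -derR X f g := by
  have : CompleteSpace E := FiniteDimensional.complete ℝ E
  obtain ⟨γ, hγ⟩ := exists_isOneParam X
  have h := hγ.comp_mul I (-1)
  rw [neg_one_smul] at h
  rw [hγ.derR_eq, h.derR_eq]
  simpa using deriv_comp_neg (fun t => f (γ t * g)) 0

/-! ### The reduced evolution equations -/

theorem sliceDeriv₁_eq_redBracket₁ (hs : ∀ X Y, B X Y = B Y X)
    (hneg : ∀ X, X ≠ 0 → B X X < 0) {hT : IsTorus T} (hW : W = torusAlgebra I T hT)
    {φ : G → ℝ} (hφ : IsClassFunction I φ) {F : G × G → ℝ} (hF : IsSmoothSlice₁ I T F)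
    {p : G × G} (hp : p ∈ slice₁ T) {w : TangentSpace (I.prod I) p}
    (h1 : w.1 = -rmulVec I (proj0 B W (nabla B φ p.2)) p.1)
    (h2 : w.2 = commVec I p.2 (rMatrix B W p.1 (nabla B φ p.2))) :
    sliceDeriv₁ I T F p w = redBracket₁ B W F (fun q => φ q.2) p := by
  have hd := hF.mdifferentiableWithinAt hp
  have hX : -proj0 B W (nabla B φ p.2) ∈ torusAlgebra I T hT :=
    hW ▸ W.neg_mem (proj0_mem hneg _)
  rw [sliceDeriv₁_apply hp.1 hd hX (h1.trans (rmulVec_neg _ _).symm),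
    redBracket₁_comp_snd hneg hφ, apply_nablaT₁ hneg hW hp.1 hd hs, nabla₂, nabla₂',
    apply_nabla'_sub_nabla hs hneg (hasMFDerivAt_slice_snd hp.1 hd).mdifferentiableAt,
    derR_neg, h2]

theorem sliceDeriv₂_eq_redBracket₂ (hs : ∀ X Y, B X Y = B Y X)
    (hneg : ∀ X, X ≠ 0 → B X X < 0) {hT : IsTorus T} (hW : W = torusAlgebra I T hT)
    {φ : G → ℝ} (hφ : IsClassFunction I φ) {F : G × G → ℝ} (hF : IsSmoothSlice₂ I T F)
    {p : G × G} (hp : p ∈ slice₂ T) {w : TangentSpace (I.prod I) p}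
    (h1 : w.2 = rmulVec I (proj0 B W (nabla B φ p.1)) p.2)
    (h2 : w.1 = -commVec I p.1 (rMatrix B W p.2 (nabla B φ p.1))) :
    sliceDeriv₂ I T F p w = redBracket₂ B W F (fun q => φ q.1) p := by
  have hd := hF.mdifferentiableWithinAt hp
  have hX : proj0 B W (nabla B φ p.1) ∈ torusAlgebra I T hT := hW ▸ proj0_mem hneg _
  rw [sliceDeriv₂_apply hp.1 hd hX h1,
    redBracket₂_comp_fst hneg hφ, apply_nablaT₂ hneg hW hp.1 hd hs, nabla₁, nabla₁',
    apply_nabla'_sub_nabla hs hneg (hasMFDerivAt_slice_fst hp.1 hd).mdifferentiableAt, h2,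
    sub_eq_add_neg]
  exact congrArg (derR _ _ _ + ·) (map_neg (mfderiv I 𝓘(ℝ, ℝ) _ _ : E →L[ℝ] ℝ) _)

/-! ### Separating vectors tangent to the slices by smooth functions -/

theorem sliceDeriv₁_comp_fst {f : G → ℝ} (hf : ContMDiff I 𝓘(ℝ, ℝ) ∞ f) {p : G × G}
    (hp : p ∈ slice₁ T) {hT : IsTorus T} {X : GroupLieAlgebra I G}
    (hX : X ∈ torusAlgebra I T hT) {w : TangentSpace (I.prod I) p}
    (hw : w.1 = rmulVec I X p.1) :
    sliceDeriv₁ I T (fun q => f q.1) p w = dirDeriv I f p.1 w.1 := by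
  have : CompleteSpace E := FiniteDimensional.complete ℝ E
  have hs := (hf.comp (contMDiff_fst (I := I) (J := I) (M := G) (N := G))).isSmoothSlice₁ T
  refine (sliceDeriv₁_apply hp.1 (hs.mdifferentiableWithinAt hp) hX hw).trans ?_
  rw [hw]
  exact (congrArg (derR X f p.1 + ·) (dirDeriv_const (f p.1) p.2 w.2)).trans
    ((add_zero _).trans (derR_eq_mfderiv X (hf.mdifferentiableAt (by simp))))

omit [FiniteDimensional ℝ E] in
theorem sliceDeriv₁_comp_snd {f : G → ℝ} (hf : ContMDiff I 𝓘(ℝ, ℝ) ∞ f) {p : G × G}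
    (hp : p ∈ slice₁ T) {hT : IsTorus T} {X : GroupLieAlgebra I G}
    (hX : X ∈ torusAlgebra I T hT) {w : TangentSpace (I.prod I) p}
    (hw : w.1 = rmulVec I X p.1) :
    sliceDeriv₁ I T (fun q => f q.2) p w = dirDeriv I f p.2 w.2 := by
  have hs := (hf.comp (contMDiff_snd (I := I) (J := I) (M := G) (N := G))).isSmoothSlice₁ T
  refine (sliceDeriv₁_apply hp.1 (hs.mdifferentiableWithinAt hp) hX hw).trans ?_
  exact (congrArg (· + dirDeriv I f p.2 w.2) (derR_const X (f p.2) p.1)).trans (zero_add _)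

/-- Functions pulled back from the two factors suffice as test functions. Tangency of both vectors
is what identifies their derivatives within the slice with ordinary ones. -/
theorem eq_of_forall_sliceDeriv₁_eq {p : G × G} (hp : p ∈ slice₁ T) {hT : IsTorus T}
    {v w : TangentSpace (I.prod I) p}
    (hv : ∃ X ∈ torusAlgebra I T hT, v.1 = rmulVec I X p.1)
    (hw : ∃ X ∈ torusAlgebra I T hT, w.1 = rmulVec I X p.1)
    (h : ∀ F : G × G → ℝ, IsSmoothSlice₁ I T F → sliceDeriv₁ I T F p v = sliceDeriv₁ I T F p w) :
    v.1 = w.1 ∧ v.2 = w.2 := by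
  obtain ⟨X, hX, hvX⟩ := hv
  obtain ⟨Y, hY, hwY⟩ := hw
  constructor
  · refine eq_of_forall_dirDeriv_eq (I := I) (g := p.1) fun f hf => ?_
    have h1 := h _ ((hf.comp (contMDiff_fst (I := I) (J := I) (M := G) (N := G))).isSmoothSlice₁ T)
    exact ((sliceDeriv₁_comp_fst hf hp hX hvX).symm.trans h1).trans
      (sliceDeriv₁_comp_fst hf hp hY hwY)
  · refine eq_of_forall_dirDeriv_eq (I := I) (g := p.2) fun f hf => ?_
    have h1 := h _ ((hf.comp (contMDiff_snd (I := I) (J := I) (M := G) (N := G))).isSmoothSlice₁ T)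
    exact ((sliceDeriv₁_comp_snd hf hp hX hvX).symm.trans h1).trans
      (sliceDeriv₁_comp_snd hf hp hY hwY)

omit [FiniteDimensional ℝ E] in
theorem sliceDeriv₂_comp_fst {f : G → ℝ} (hf : ContMDiff I 𝓘(ℝ, ℝ) ∞ f) {p : G × G}
    (hp : p ∈ slice₂ T) {hT : IsTorus T} {X : GroupLieAlgebra I G}
    (hX : X ∈ torusAlgebra I T hT) {w : TangentSpace (I.prod I) p}
    (hw : w.2 = rmulVec I X p.2) :
    sliceDeriv₂ I T (fun q => f q.1) p w = dirDeriv I f p.1 w.1 := by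
  have hs := (hf.comp (contMDiff_fst (I := I) (J := I) (M := G) (N := G))).isSmoothSlice₂ T
  refine (sliceDeriv₂_apply hp.1 (hs.mdifferentiableWithinAt hp) hX hw).trans ?_
  exact (congrArg (· + dirDeriv I f p.1 w.1) (derR_const X (f p.1) p.2)).trans (zero_add _)

theorem sliceDeriv₂_comp_snd {f : G → ℝ} (hf : ContMDiff I 𝓘(ℝ, ℝ) ∞ f) {p : G × G}
    (hp : p ∈ slice₂ T) {hT : IsTorus T} {X : GroupLieAlgebra I G}
    (hX : X ∈ torusAlgebra I T hT) {w : TangentSpace (I.prod I) p}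
    (hw : w.2 = rmulVec I X p.2) :
    sliceDeriv₂ I T (fun q => f q.2) p w = dirDeriv I f p.2 w.2 := by
  have : CompleteSpace E := FiniteDimensional.complete ℝ E
  have hs := (hf.comp (contMDiff_snd (I := I) (J := I) (M := G) (N := G))).isSmoothSlice₂ T
  refine (sliceDeriv₂_apply hp.1 (hs.mdifferentiableWithinAt hp) hX hw).trans ?_
  rw [hw]
  exact (congrArg (derR X f p.2 + ·) (dirDeriv_const (f p.2) p.1 w.1)).trans
    ((add_zero _).trans (derR_eq_mfderiv X (hf.mdifferentiableAt (by simp))))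

theorem eq_of_forall_sliceDeriv₂_eq {p : G × G} (hp : p ∈ slice₂ T) {hT : IsTorus T}
    {v w : TangentSpace (I.prod I) p}
    (hv : ∃ X ∈ torusAlgebra I T hT, v.2 = rmulVec I X p.2)
    (hw : ∃ X ∈ torusAlgebra I T hT, w.2 = rmulVec I X p.2)
    (h : ∀ F : G × G → ℝ, IsSmoothSlice₂ I T F → sliceDeriv₂ I T F p v = sliceDeriv₂ I T F p w) :
    v.1 = w.1 ∧ v.2 = w.2 := by
  obtain ⟨X, hX, hvX⟩ := hv
  obtain ⟨Y, hY, hwY⟩ := hw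
  constructor
  · refine eq_of_forall_dirDeriv_eq (I := I) (g := p.1) fun f hf => ?_
    have h1 := h _ ((hf.comp (contMDiff_fst (I := I) (J := I) (M := G) (N := G))).isSmoothSlice₂ T)
    exact ((sliceDeriv₂_comp_fst hf hp hX hvX).symm.trans h1).trans
      (sliceDeriv₂_comp_fst hf hp hY hwY)
  · refine eq_of_forall_dirDeriv_eq (I := I) (g := p.2) fun f hf => ?_
    have h1 := h _ ((hf.comp (contMDiff_snd (I := I) (J := I) (M := G) (N := G))).isSmoothSlice₂ T)
    exact ((sliceDeriv₂_comp_snd hf hp hX hvX).symm.trans h1).trans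
      (sliceDeriv₂_comp_snd hf hp hY hwY)

end SliceDerivative

/-! ### Uniqueness of the reduced vector fields, and their integral curves -/

section ReducedEquations

variable {E : Type*} [NormedAddCommGroup E] [NormedSpace ℝ E] [FiniteDimensional ℝ E]
  {H : Type*} [TopologicalSpace H] {I : ModelWithCorners ℝ E H}
  {G : Type*} [TopologicalSpace G] [ChartedSpace H G] [Group G] [LieGroup I ∞ G] [T2Space G]
  [BoundarylessManifold I G] {B : LinearMap.BilinForm ℝ (GroupLieAlgebra I G)}
  {W : Submodule ℝ (GroupLieAlgebra I G)} {T : Subgroup G}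

theorem forall_sliceDeriv₁_eq_redBracket₁_iff (hs : ∀ X Y, B X Y = B Y X)
    (hneg : ∀ X, X ≠ 0 → B X X < 0) {hT : IsTorus T} (hW : W = torusAlgebra I T hT)
    {φ : G → ℝ} (hφ : IsClassFunction I φ)
    {p : G × G} (hp : p ∈ slice₁ T) (w : TangentSpace (I.prod I) p) :
    ((∃ X ∈ W, w.1 = rmulVec I X p.1) ∧ ∀ F : G × G → ℝ, IsSmoothSlice₁ I T F →
        sliceDeriv₁ I T F p w = redBracket₁ B W F (fun q => φ q.2) p) ↔
      (w.1 = -rmulVec I (proj0 B W (nabla B φ p.2)) p.1 ∧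
        w.2 = commVec I p.2 (rMatrix B W p.1 (nabla B φ p.2))) := by
  have hmem : ∃ X ∈ W, -rmulVec I (proj0 B W (nabla B φ p.2)) p.1 = rmulVec I X p.1 :=
    ⟨_, W.neg_mem (proj0_mem hneg _), (rmulVec_neg _ _).symm⟩
  constructor
  · rintro ⟨hw, h⟩
    rw [hW] at hw hmem
    have h1 := eq_of_forall_sliceDeriv₁_eq (I := I) (v := w)
      (w := (-rmulVec I (proj0 B W (nabla B φ p.2)) p.1, commVec I p.2 (rMatrix B W p.1 (nabla B φ p.2)))) hp hw (hW ▸ hmem) fun F hF =>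
        (h F hF).trans (sliceDeriv₁_eq_redBracket₁ hs hneg hW hφ hF hp rfl rfl).symm
    exact h1
  · rintro ⟨h1, h2⟩
    exact ⟨h1 ▸ hmem, fun F hF => sliceDeriv₁_eq_redBracket₁ hs hneg hW hφ hF hp h1 h2⟩

/-- The velocity of `Q` is not known beforehand to come from an element of `W`, so the pointwise
uniqueness is not invoked. Test functions of `Q` alone and of `g` alone determine the two velocities
separately. -/
theorem forall_hasDerivAt_redBracket₁_iff (hs : ∀ X Y, B X Y = B Y X)
    (hneg : ∀ X, X ≠ 0 → B X X < 0) {hT : IsTorus T} (hW : W = torusAlgebra I T hT)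
    {φ : G → ℝ} (hφ : IsClassFunction I φ)
    {J : Set ℝ} {Q g : ℝ → G} (hJ : IsOpen J) (hc : ∀ t ∈ J, (Q t, g t) ∈ slice₁ T)
    (hd : ∀ t ∈ J, MDifferentiableAt 𝓘(ℝ, ℝ) I Q t ∧ MDifferentiableAt 𝓘(ℝ, ℝ) I g t) :
    (∀ F : G × G → ℝ, IsSmoothSlice₁ I T F → ∀ t ∈ J,
        HasDerivAt (fun s => F (Q s, g s))
          (redBracket₁ B W F (fun q => φ q.2) (Q t, g t)) t) ↔
      ∀ t ∈ J,
        HasVelocity I Q t (-rmulVec I (proj0 B W (nabla B φ (g t))) (Q t)) ∧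
        HasVelocity I g t (commVec I (g t) (rMatrix B W (Q t) (nabla B φ (g t)))) := by
  have hmem (t : ℝ) : ∃ X ∈ torusAlgebra I T hT,
      -rmulVec I (proj0 B W (nabla B φ (g t))) (Q t) = rmulVec I X (Q t) :=
    hW ▸ ⟨_, W.neg_mem (proj0_mem hneg _), (rmulVec_neg _ _).symm⟩
  constructor
  · intro h t ht
    obtain ⟨u, hu⟩ := (hd t ht).1.exists_hasVelocity
    obtain ⟨v, hv⟩ := (hd t ht).2.exists_hasVelocity
    obtain ⟨X, hX, hQ⟩ := hmem t
    have hw (F : G × G → ℝ) (hF : IsSmoothSlice₁ I T F) :=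
      sliceDeriv₁_eq_redBracket₁ hs hneg hW hφ hF (hc t ht)
        (w := (-rmulVec I (proj0 B W (nabla B φ (g t))) (Q t), commVec I (g t) (rMatrix B W (Q t) (nabla B φ (g t))))) rfl rfl
    constructor
    · convert hu
      refine (eq_of_forall_dirDeriv_eq (I := I) (g := Q t) fun f hf => ?_).symm
      have hF := (hf.comp (contMDiff_fst (I := I) (J := I) (M := G) (N := G))).isSmoothSlice₁ T
      exact ((hu.hasDerivAt_comp (hf.mdifferentiableAt (by simp))).unique (h _ hF t ht)).trans
        ((hw _ hF).symm.trans (sliceDeriv₁_comp_fst hf (hc t ht) hX hQ))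
    · convert hv
      refine (eq_of_forall_dirDeriv_eq (I := I) (g := g t) fun f hf => ?_).symm
      have hF := (hf.comp (contMDiff_snd (I := I) (J := I) (M := G) (N := G))).isSmoothSlice₁ T
      exact ((hv.hasDerivAt_comp (hf.mdifferentiableAt (by simp))).unique (h _ hF t ht)).trans
        ((hw _ hF).symm.trans (sliceDeriv₁_comp_snd hf (hc t ht) hX hQ))
  · intro h F hF t ht
    rw [← sliceDeriv₁_eq_redBracket₁ hs hneg hW hφ hF (hc t ht)
      (w := (-rmulVec I (proj0 B W (nabla B φ (g t))) (Q t), commVec I (g t) (rMatrix B W (Q t) (nabla B φ (g t))))) rfl rfl]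
    exact ((h t ht).1.prodMk (h t ht).2).hasDerivAt_comp_within (f := F)
      (hF.mdifferentiableWithinAt (hc t ht))
      -- Openness of `J` keeps `Q` in the torus for all times near `t`.
      (Filter.mem_of_superset (hJ.mem_nhds ht) fun s hs => (hc s hs).1)

theorem forall_sliceDeriv₂_eq_redBracket₂_iff (hs : ∀ X Y, B X Y = B Y X)
    (hneg : ∀ X, X ≠ 0 → B X X < 0) {hT : IsTorus T} (hW : W = torusAlgebra I T hT)
    {φ : G → ℝ} (hφ : IsClassFunction I φ)
    {p : G × G} (hp : p ∈ slice₂ T) (w : TangentSpace (I.prod I) p) :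
    ((∃ X ∈ W, w.2 = rmulVec I X p.2) ∧ ∀ F : G × G → ℝ, IsSmoothSlice₂ I T F →
        sliceDeriv₂ I T F p w = redBracket₂ B W F (fun q => φ q.1) p) ↔
      (w.2 = rmulVec I (proj0 B W (nabla B φ p.1)) p.2 ∧
        w.1 = -commVec I p.1 (rMatrix B W p.2 (nabla B φ p.1))) := by
  have hmem : ∃ X ∈ W, rmulVec I (proj0 B W (nabla B φ p.1)) p.2 = rmulVec I X p.2 :=
    ⟨_, proj0_mem hneg _, rfl⟩
  constructor
  · rintro ⟨hw, h⟩
    rw [hW] at hw hmem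
    have h1 := eq_of_forall_sliceDeriv₂_eq (I := I) (v := w)
      (w := (-commVec I p.1 (rMatrix B W p.2 (nabla B φ p.1)), rmulVec I (proj0 B W (nabla B φ p.1)) p.2)) hp hw (hW ▸ hmem) fun F hF =>
        (h F hF).trans (sliceDeriv₂_eq_redBracket₂ hs hneg hW hφ hF hp rfl rfl).symm
    -- This swaps the conjunction, since here the torus component is the second one.
    exact h1.symm
  · rintro ⟨h1, h2⟩
    exact ⟨h1 ▸ hmem, fun F hF => sliceDeriv₂_eq_redBracket₂ hs hneg hW hφ hF hp h1 h2⟩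

theorem forall_hasDerivAt_redBracket₂_iff (hs : ∀ X Y, B X Y = B Y X)
    (hneg : ∀ X, X ≠ 0 → B X X < 0) {hT : IsTorus T} (hW : W = torusAlgebra I T hT)
    {φ : G → ℝ} (hφ : IsClassFunction I φ)
    {J : Set ℝ} {g Q : ℝ → G} (hJ : IsOpen J) (hc : ∀ t ∈ J, (g t, Q t) ∈ slice₂ T)
    (hd : ∀ t ∈ J, MDifferentiableAt 𝓘(ℝ, ℝ) I g t ∧ MDifferentiableAt 𝓘(ℝ, ℝ) I Q t) :
    (∀ F : G × G → ℝ, IsSmoothSlice₂ I T F → ∀ t ∈ J,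
        HasDerivAt (fun s => F (g s, Q s))
          (redBracket₂ B W F (fun q => φ q.1) (g t, Q t)) t) ↔
      ∀ t ∈ J,
        HasVelocity I Q t (rmulVec I (proj0 B W (nabla B φ (g t))) (Q t)) ∧
        HasVelocity I g t (-commVec I (g t) (rMatrix B W (Q t) (nabla B φ (g t)))) := by
  have hmem (t : ℝ) : ∃ X ∈ torusAlgebra I T hT,
      rmulVec I (proj0 B W (nabla B φ (g t))) (Q t) = rmulVec I X (Q t) :=
    hW ▸ ⟨_, proj0_mem hneg _, rfl⟩
  constructor
  · intro h t ht
    obtain ⟨u, hu⟩ := (hd t ht).2.exists_hasVelocity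
    obtain ⟨v, hv⟩ := (hd t ht).1.exists_hasVelocity
    obtain ⟨X, hX, hQ⟩ := hmem t
    have hw (F : G × G → ℝ) (hF : IsSmoothSlice₂ I T F) :=
      sliceDeriv₂_eq_redBracket₂ hs hneg hW hφ hF (hc t ht)
        (w := (-commVec I (g t) (rMatrix B W (Q t) (nabla B φ (g t))), rmulVec I (proj0 B W (nabla B φ (g t))) (Q t))) rfl rfl
    constructor
    · convert hu
      refine (eq_of_forall_dirDeriv_eq (I := I) (g := Q t) fun f hf => ?_).symm
      have hF := (hf.comp (contMDiff_snd (I := I) (J := I) (M := G) (N := G))).isSmoothSlice₂ T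
      exact ((hu.hasDerivAt_comp (hf.mdifferentiableAt (by simp))).unique (h _ hF t ht)).trans
        ((hw _ hF).symm.trans (sliceDeriv₂_comp_snd hf (hc t ht) hX hQ))
    · convert hv
      refine (eq_of_forall_dirDeriv_eq (I := I) (g := g t) fun f hf => ?_).symm
      have hF := (hf.comp (contMDiff_fst (I := I) (J := I) (M := G) (N := G))).isSmoothSlice₂ T
      exact ((hv.hasDerivAt_comp (hf.mdifferentiableAt (by simp))).unique (h _ hF t ht)).trans
        ((hw _ hF).symm.trans (sliceDeriv₂_comp_fst hf (hc t ht) hX hQ))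
  · intro h F hF t ht
    rw [← sliceDeriv₂_eq_redBracket₂ hs hneg hW hφ hF (hc t ht)
      (w := (-commVec I (g t) (rMatrix B W (Q t) (nabla B φ (g t))), rmulVec I (proj0 B W (nabla B φ (g t))) (Q t))) rfl rfl]
    exact ((h t ht).2.prodMk (h t ht).1).hasDerivAt_comp_within (f := F)
      (hF.mdifferentiableWithinAt (hc t ht))
      (Filter.mem_of_superset (hJ.mem_nhds ht) fun s hs => (hc s hs).1)

end ReducedEquations

end QPDouble

end

open QPDouble in
theorem proposition4p4 {n : ℕ} {G : Type*} [TopologicalSpace G]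
    [ChartedSpace (EuclideanSpace ℝ (Fin n)) G] [Group G] [LieGroup (𝓡 n) ∞ G]
    [T2Space G] [CompactSpace G] [SimplyConnectedSpace G]
    [LieAlgebra.IsSimple ℝ (GroupLieAlgebra (𝓡 n) G)]
    (B : LinearMap.BilinForm ℝ (GroupLieAlgebra (𝓡 n) G))
    (hB : ∃ c : ℝ, B = c • killingForm ℝ (GroupLieAlgebra (𝓡 n) G))
    (hneg : ∀ X, X ≠ 0 → B X X < 0)
    (e : Module.Basis (Fin n) ℝ (GroupLieAlgebra (𝓡 n) G))
    (he : ∀ a b, B (e a) (e b) = if a = b then -1 else 0)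
    (T : Subgroup G) (hT : IsMaximalTorus T)
    (W : Submodule ℝ (GroupLieAlgebra (𝓡 n) G)) (hW : W = torusAlgebra (𝓡 n) T hT.prop)
    (φ : G → ℝ) (hφ : IsClassFunction (𝓡 n) φ) :
    -- the slice of pairs `(Q, g)` and the Hamiltonian `(g₁, g₂) ↦ φ g₂`
    ((∀ F : G × G → ℝ, IsSmoothInvariantOn (𝓡 n) regSet₁ F → ∀ p ∈ slice₁ T,
        qpBracket e F (fun q => φ q.2) p =
          - B (nablaT₁ B W F p) (nabla B φ p.2)
            + B (nabla₂' B F p - nabla₂ B F p) (rMatrix B W p.1 (nabla B φ p.2))) ∧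
      (∀ F : G × G → ℝ, IsSmoothSlice₁ (𝓡 n) T F → ∀ p ∈ slice₁ T,
        redBracket₁ B W F (fun q => φ q.2) p =
          - B (nablaT₁ B W F p) (nabla B φ p.2)
            + B (nabla₂' B F p - nabla₂ B F p) (rMatrix B W p.1 (nabla B φ p.2))) ∧
      (∀ p ∈ slice₁ T, ∀ w : TangentSpace ((𝓡 n).prod (𝓡 n)) p,
        ((∃ X ∈ W, w.1 = rmulVec (𝓡 n) X p.1) ∧
          ∀ F : G × G → ℝ, IsSmoothSlice₁ (𝓡 n) T F →
            sliceDeriv₁ (𝓡 n) T F p w = redBracket₁ B W F (fun q => φ q.2) p) ↔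
        (w.1 = - rmulVec (𝓡 n) (proj0 B W (nabla B φ p.2)) p.1 ∧
          w.2 = commVec (𝓡 n) p.2 (rMatrix B W p.1 (nabla B φ p.2)))) ∧
      (∀ (J : Set ℝ) (Q g : ℝ → G), IsOpen J → (∀ t ∈ J, (Q t, g t) ∈ slice₁ T) →
        (∀ t ∈ J, MDifferentiableAt 𝓘(ℝ, ℝ) (𝓡 n) Q t ∧ MDifferentiableAt 𝓘(ℝ, ℝ) (𝓡 n) g t) →
        ((∀ F : G × G → ℝ, IsSmoothSlice₁ (𝓡 n) T F → ∀ t ∈ J,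
            HasDerivAt (fun s => F (Q s, g s))
              (redBracket₁ B W F (fun q => φ q.2) (Q t, g t)) t) ↔
          ∀ t ∈ J,
            HasMFDerivAt 𝓘(ℝ, ℝ) (𝓡 n) Q t ((1 : ℝ →L[ℝ] ℝ).smulRight
              (- rmulVec (𝓡 n) (proj0 B W (nabla B φ (g t))) (Q t))) ∧
            HasMFDerivAt 𝓘(ℝ, ℝ) (𝓡 n) g t ((1 : ℝ →L[ℝ] ℝ).smulRight
              (commVec (𝓡 n) (g t) (rMatrix B W (Q t) (nabla B φ (g t)))))))) ∧
    -- the slice of pairs `(g, Q)` and the Hamiltonian `(g₁, g₂) ↦ φ g₁`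
    ((∀ F : G × G → ℝ, IsSmoothInvariantOn (𝓡 n) regSet₂ F → ∀ p ∈ slice₂ T,
        qpBracket e F (fun q => φ q.1) p =
          B (nablaT₂ B W F p) (nabla B φ p.1)
            - B (nabla₁' B F p - nabla₁ B F p) (rMatrix B W p.2 (nabla B φ p.1))) ∧
      (∀ F : G × G → ℝ, IsSmoothSlice₂ (𝓡 n) T F → ∀ p ∈ slice₂ T,
        redBracket₂ B W F (fun q => φ q.1) p =
          B (nablaT₂ B W F p) (nabla B φ p.1)
            - B (nabla₁' B F p - nabla₁ B F p) (rMatrix B W p.2 (nabla B φ p.1))) ∧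
      (∀ p ∈ slice₂ T, ∀ w : TangentSpace ((𝓡 n).prod (𝓡 n)) p,
        ((∃ X ∈ W, w.2 = rmulVec (𝓡 n) X p.2) ∧
          ∀ F : G × G → ℝ, IsSmoothSlice₂ (𝓡 n) T F →
            sliceDeriv₂ (𝓡 n) T F p w = redBracket₂ B W F (fun q => φ q.1) p) ↔
        (w.2 = rmulVec (𝓡 n) (proj0 B W (nabla B φ p.1)) p.2 ∧
          w.1 = - commVec (𝓡 n) p.1 (rMatrix B W p.2 (nabla B φ p.1)))) ∧
      (∀ (J : Set ℝ) (g Q : ℝ → G), IsOpen J → (∀ t ∈ J, (g t, Q t) ∈ slice₂ T) →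
        (∀ t ∈ J, MDifferentiableAt 𝓘(ℝ, ℝ) (𝓡 n) g t ∧ MDifferentiableAt 𝓘(ℝ, ℝ) (𝓡 n) Q t) →
        ((∀ F : G × G → ℝ, IsSmoothSlice₂ (𝓡 n) T F → ∀ t ∈ J,
            HasDerivAt (fun s => F (g s, Q s))
              (redBracket₂ B W F (fun q => φ q.1) (g t, Q t)) t) ↔
          ∀ t ∈ J,
            HasMFDerivAt 𝓘(ℝ, ℝ) (𝓡 n) Q t ((1 : ℝ →L[ℝ] ℝ).smulRight
              (rmulVec (𝓡 n) (proj0 B W (nabla B φ (g t))) (Q t))) ∧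
            HasMFDerivAt 𝓘(ℝ, ℝ) (𝓡 n) g t ((1 : ℝ →L[ℝ] ℝ).smulRight
              (- commVec (𝓡 n) (g t) (rMatrix B W (Q t) (nabla B φ (g t)))))))) := by
  have hs : ∀ X Y, B X Y = B Y X := by
    obtain ⟨c, rfl⟩ := hB
    intro X Y
    simp only [LinearMap.smul_apply]
    rw [LieModule.traceForm_comm]
  -- Proportionality to the Killing form enters only through symmetry and this invariance.
  have hAd : ∀ (g : G) X Y, B (Ad (𝓡 n) g X) (Ad (𝓡 n) g Y) = B X Y := by
    obtain ⟨c, rfl⟩ := hB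
    intro g X Y
    simp only [LinearMap.smul_apply]
    rw [killingForm_Ad_Ad]
  exact
    ⟨⟨fun F hF p hp => qpBracket_comp_snd_eq hs hneg hAd e he hT hW hφ hF hp,
      fun F _ p _ => redBracket₁_comp_snd hneg hφ F p,
      fun p hp w => forall_sliceDeriv₁_eq_redBracket₁_iff hs hneg hW hφ hp w,
      fun J Q g hJ hc hd => forall_hasDerivAt_redBracket₁_iff hs hneg hW hφ hJ hc hd⟩,
    ⟨fun F hF p hp => qpBracket_comp_fst_eq hs hneg hAd e he hT hW hφ hF hp,
      fun F _ p _ => redBracket₂_comp_fst hneg hφ F p,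
      fun p hp w => forall_sliceDeriv₂_eq_redBracket₂_iff hs hneg hW hφ hp w,
      fun J g Q hJ hc hd => forall_hasDerivAt_redBracket₂_iff hs hneg hW hφ hJ hc hd⟩⟩
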